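/- Let $d\ge 1$ be an integer and let $H\in(0,1)$ satisfy $1\le Hd<\frac32$. Let $T>0$, let $k>0$, and let $\gamma>\left(\frac12+H\right)\left(d-\frac1{2H}\right)$. Then there is a constant $C>0$, depending only on $d,H,T,k,\gamma$, such that the following holds. Let $B=(B_t)_{t\ge0}$ be a $d$-dimensional fractional Brownian motion with Hurst parameter $H$ on a probability space, i.e. a centred Gaussian process in $\mathbb R^d$ with $E(B^i_tB^j_s)=\frac{\delta_{ij}}2\left(t^{2H}+s^{2H}-|t-s|^{2H}\right)$, and let $\mathcal F_r=\sigma(B_u:0\le u\le r)$. For $0\le r\le T$ let $A_{r,t,s}=E(B_t-B_s\mid\mathcal F_r)$ (any version that is jointly measurable in $(t,s,\omega)$), and for $\varepsilon>0$ and $0\le s<r<t\le T$ put $$\Psi_\varepsilon(r,t,s)=\left(\varepsilon+k(t-r)^{2H}\right)^{-\frac{d+1}2}(t-r)^{H-\frac12}\exp\left(-\frac{|A_{r,t,s}|^2}{4\left(\varepsilon+(t-r)^{2H}\right)}\right),$$ where $|\cdot|$ is the Euclidean norm, and $$\Lambda_\varepsilon(r)=\int_r^T\int_0^r\Psi_\varepsilon(r,t,s)\,ds\,dt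 .$$ Then $$E\left(\Lambda_\varepsilon(r)^n\right)\le C^n(n!)^\gamma$$ for all integers $n\ge1$, all $\varepsilon>0$ and all $r\in[0,T]$. -/

import Mathlib

open MeasureTheory ProbabilityTheory
open scoped NNReal ENNReal

/-- `B = (B_t)_{t ≥ 0}` is a `d`-dimensional fractional Brownian motion with Hurst parameter `H`:
a centred Gaussian process in `ℝ^d` with
`E (B_t^i B_s^j) = (δ_ij / 2) (t^{2H} + s^{2H} - |t - s|^{2H})`. -/
structure IsFractionalBrownianMotion {Ω : Type*} [MeasurableSpace Ω] (P : Measure Ω) {d : ℕ}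
    (H : ℝ) (B : ℝ≥0 → Ω → EuclideanSpace ℝ (Fin d)) : Prop where
  measurable : ∀ t, Measurable (B t)
  gaussian : IsGaussianProcess B P
  mean_zero : ∀ (t : ℝ≥0) (i : Fin d), ∫ ω, B t ω i ∂P = 0
  covariance : ∀ (t s : ℝ≥0) (i j : Fin d),
    ∫ ω, B t ω i * B s ω j ∂P =
      if i = j then
        ((t : ℝ) ^ (2 * H) + (s : ℝ) ^ (2 * H) - |(t : ℝ) - (s : ℝ)| ^ (2 * H)) / 2
      else 0

/-- The `σ`-algebra `F_r = σ(B_u : 0 ≤ u ≤ r)` (all components of the process). -/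
abbrev pastSigmaAlgebra {Ω : Type*} {d : ℕ} (B : ℝ≥0 → Ω → EuclideanSpace ℝ (Fin d)) (r : ℝ≥0) :
    MeasurableSpace Ω :=
  ⨆ u : ℝ≥0, ⨆ _ : u ≤ r, MeasurableSpace.comap (B u) inferInstance

/-- `A t s ω` is a version of the random field `A_{r,t,s} = E (B_t - B_s | F_r)`, `t, s ≥ 0`, that
is jointly measurable in `(t, s, ω)`. A conditional expectation is determined only almost surely
for each `(t, s)`; joint measurability is what makes integration in `(t, s)` meaningful. -/
structure IsCondIncrement {Ω : Type*} [MeasurableSpace Ω] (P : Measure Ω) {d : ℕ}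
    (B : ℝ≥0 → Ω → EuclideanSpace ℝ (Fin d)) (r : ℝ≥0)
    (A : ℝ → ℝ → Ω → EuclideanSpace ℝ (Fin d)) : Prop where
  measurable : Measurable fun p : ℝ × ℝ × Ω => A p.1 p.2.1 p.2.2
  version : ∀ t s : ℝ≥0,
    A (t : ℝ) (s : ℝ) =ᵐ[P] P[fun ω => B t ω - B s ω | pastSigmaAlgebra B r]

/-- `Ψ_ε(r,t,s) = (ε + k (t-r)^{2H})^{-(d+1)/2} (t-r)^{H-1/2} exp (-|a|² / (4 (ε + (t-r)^{2H})))`,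
where `a` stands for the value of `A_{r,t,s}`. -/
noncomputable def Psi {d : ℕ} (H k ε r t : ℝ) (a : EuclideanSpace ℝ (Fin d)) : ℝ :=
  (ε + k * (t - r) ^ (2 * H)) ^ (-(((d : ℝ) + 1) / 2)) * (t - r) ^ (H - 1 / 2) *
    Real.exp (-(‖a‖ ^ 2 / (4 * (ε + (t - r) ^ (2 * H)))))

/-- `Λ_ε(r) = ∫_r^T ∫_0^r Ψ_ε(r,t,s) ds dt`, as a random variable with values in `[0, ∞]`
(the integrand is nonnegative). -/
noncomputable def Lam {Ω : Type*} {d : ℕ} (H k T ε r : ℝ)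
    (A : ℝ → ℝ → Ω → EuclideanSpace ℝ (Fin d)) (ω : Ω) : ℝ≥0∞ :=
  ∫⁻ t in Set.Icc r T, ∫⁻ s in Set.Icc 0 r, ENNReal.ofReal (Psi H k ε r t (A t s ω))

/-! The bound obtained is `E Λ^n ≤ M^n n!`. It suffices because the threshold `(1/2 + H)(d -
1/(2H))` is at least 1 when `Hd ≥ 1` (`one_le_critical_exponent`).

Fix `t`, put `b = ε + (t-r)^{2H}` and `X_t = ∫_0^r exp(-|A_{r,t,s}|²/(4b)) ds`. The `n`-th moment of
`X_t` is an integral over `s_1, …, s_n` of expected products of Gaussian weights. Since `B_t = E(B_t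
| F_r) + N` with `N` independent of `F_r` and `E|N|² ≤ d (t-r)^{2H}`, each `A_{r,t,s}` can be
replaced by `B_t - B_s`, and `4b` by `8b`, at the price of a factor `e^{d/4}` per point
(`lintegral_condIncr_weight_le`).

Now regress the increment at one point `s` on those at the others. Strong local nondeterminism
(`exists_le_sum_incrCov`) bounds the residual variance below by `c ρ^{2H}`, where `ρ` is the
distance from `s` to the nearest of `t` and the other points. Integrating out the residual yields a
factor `min(1, √(4b/(c ρ^{2H})))^d`, at most a constant times `b^{a/(2H)} ρ^{-a}` for any `0 < a ≤
Hd`. Bounding `ρ^{-a}` by the sum of `|s-x|^{-a}` over these points, the `j`-th integration costs at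
most `jK` if `a < 1`. Hence `E X_t^n ≤ (C b^{a/(2H)})^n n!` (`lintegral_prod_mul_pow_le`).

Jensen's inequality in `t` keeps the single `n!` (`lintegral_lintegral_mul_pow_le`) and leaves a
singularity `(t-r)^{-(Hd+1/2-a)}`. The choice `a = (Hd+1/2)/2` makes the two singularities equal,
and `a < 1` is exactly `Hd < 3/2`.

Nondeterminism comes from the spectral measure: the variance of a combination of increments is a
weighted `L²` norm of a trigonometric sum, which is tested against a Schwartz function isolating one
point. -/

/-! ### Spectral representation and strong local nondeterminism. -/

open scoped FourierTransform SchwartzMap in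
/-- There is a smooth function with compact support in `(-1, 1)` and value `1` at `0`, written as
an inverse Fourier integral. -/
theorem exists_schwartz_test_function :
    ∃ ψ : 𝓢(ℝ, ℂ), (∫ y, Complex.exp (↑(2 * Real.pi * (0 * y)) * Complex.I) * ψ y = 1) ∧
      ∀ z : ℝ, 1 ≤ |z| →
        ∫ y, Complex.exp (↑(2 * Real.pi * (z * y)) * Complex.I) * ψ y = 0 := by
  let g : ContDiffBump (0 : ℝ) := ⟨1 / 2, 1, by norm_num, by norm_num⟩
  have hc : HasCompactSupport (fun x : ℝ => ((g x : ℝ) : ℂ)) :=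
    g.hasCompactSupport.comp_left (g := fun x : ℝ => (x : ℂ)) (by simp)
  have hs : ContDiff ℝ ((⊤ : ℕ∞) : WithTop ℕ∞) (fun x : ℝ => ((g x : ℝ) : ℂ)) :=
    Complex.ofRealCLM.contDiff.comp g.contDiff
  let f : 𝓢(ℝ, ℂ) := hc.toSchwartzMap hs
  have key : ∀ z : ℝ,
      ∫ y, Complex.exp (↑(2 * Real.pi * (z * y)) * Complex.I) * (𝓕 f) y = (g z : ℂ) := by
    intro z
    have h1 : 𝓕⁻ (𝓕 f) = f := FourierPair.fourierInv_fourier_eq f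
    have h2 : (𝓕⁻ (𝓕 f)) z = f z := by rw [h1]
    rw [SchwartzMap.fourierInv_coe, Real.fourierInv_eq'] at h2
    simpa [f, inner] using h2
  refine ⟨𝓕 f, ?_, ?_⟩
  · rw [key]
    have : g 0 = 1 := g.one_of_mem_closedBall (by simp [g])
    simp [this]
  · intro z hz
    rw [key]
    have : g z = 0 := g.zero_of_le_dist (by simpa [g] using hz)
    simp [this]

theorem MeasureTheory.IntegrableOn.integrable_of_even {f : ℝ → ℝ}
    (hf : IntegrableOn f (Set.Ioi 0)) (heven : ∀ x, f (-x) = f x) : Integrable f := by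
  have h1 : Integrable ((Set.Ioi (0 : ℝ)).indicator f) :=
    (integrable_indicator_iff measurableSet_Ioi).2 hf
  refine (h1.add h1.comp_neg).congr ?_
  have h0 : ∀ᵐ x : ℝ, x ≠ 0 := by simp [ae_iff]
  filter_upwards [h0] with x hx
  rcases lt_or_gt_of_ne hx with h | h
  · simp [Set.indicator, heven, h, h.le]
  · simp [Set.indicator, h, h.le]

/-- Near 0 the integrand is `O(y^{1-2H})`, integrable because `H < 1`; at infinity it is at most `2
y^{-1-2H}`, integrable because `H > 0`. -/
theorem integrable_one_sub_cos_mul_rpow {H : ℝ} (hH0 : 0 < H) (hH1 : H < 1) (z : ℝ) :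
    Integrable fun y : ℝ => (1 - Real.cos (2 * Real.pi * (z * y))) * |y| ^ (-1 - 2 * H) := by
  apply IntegrableOn.integrable_of_even
  swap
  · intro x; simp
  rw [← Set.Ioc_union_Ioi_eq_Ioi (zero_le_one' ℝ)]
  have hm : Measurable
      fun y : ℝ => (1 - Real.cos (2 * Real.pi * (z * y))) * |y| ^ (-1 - 2 * H) := by fun_prop
  apply IntegrableOn.union
  · have h : IntegrableOn (fun y : ℝ => (2 * Real.pi * z) ^ 2 / 2 * y ^ (1 - 2 * H))
        (Set.Ioc 0 1) := by
      have := (intervalIntegral.intervalIntegrable_rpow' (a := 0) (b := 1)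
        (r := 1 - 2 * H) (by linarith)).const_mul ((2 * Real.pi * z) ^ 2 / 2)
      rwa [intervalIntegrable_iff_integrableOn_Ioc_of_le zero_le_one] at this
    refine Integrable.mono' h hm.aestronglyMeasurable ?_
    refine (ae_restrict_iff' measurableSet_Ioc).2 (Filter.Eventually.of_forall fun y hy => ?_)
    have hy0 : 0 < y := hy.1
    have e : y ^ (1 - 2 * H) = y ^ 2 * y ^ (-1 - 2 * H) := by
      rw [← Real.rpow_natCast y 2, ← Real.rpow_add hy0]; congr 1; push_cast; ring
    have h1 := Real.one_sub_sq_div_two_le_cos (x := 2 * Real.pi * (z * y))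
    have h2 := Real.cos_le_one (2 * Real.pi * (z * y))
    have h3 := Real.rpow_nonneg hy0.le (-1 - 2 * H)
    rw [Real.norm_eq_abs, abs_of_pos hy0, abs_of_nonneg (mul_nonneg (by linarith) h3), e,
      ← mul_assoc (_ / 2)]
    refine mul_le_mul_of_nonneg_right ?_ h3
    nlinarith
  · have h := (integrableOn_Ioi_rpow_of_lt (a := -1 - 2 * H) (by linarith)
      one_pos).const_mul 2
    refine Integrable.mono' h hm.aestronglyMeasurable ?_
    refine (ae_restrict_iff' measurableSet_Ioi).2 (Filter.Eventually.of_forall fun y hy => ?_)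
    have hy0 : 0 < y := lt_trans one_pos hy
    have h1 := Real.neg_one_le_cos (2 * Real.pi * (z * y))
    have h2 := Real.cos_le_one (2 * Real.pi * (z * y))
    have h3 := Real.rpow_nonneg hy0.le (-1 - 2 * H)
    rw [Real.norm_eq_abs, abs_of_pos hy0, abs_of_nonneg (mul_nonneg (by linarith) h3)]
    exact mul_le_mul_of_nonneg_right (by linarith) h3

/-- The spectral representation of `|z| ^ (2 * H)`. -/
theorem integral_one_sub_cos_mul_rpow {H : ℝ} (hH0 : 0 < H) (z : ℝ) :
    ∫ y : ℝ, (1 - Real.cos (2 * Real.pi * (z * y))) * |y| ^ (-1 - 2 * H) =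
      |z| ^ (2 * H) * ∫ y : ℝ, (1 - Real.cos (2 * Real.pi * y)) * |y| ^ (-1 - 2 * H) := by
  rcases eq_or_ne z 0 with rfl | hz
  · simp [Real.zero_rpow (by linarith : 2 * H ≠ 0)]
  have hz' : 0 < |z| := abs_pos.2 hz
  have h := Measure.integral_comp_mul_left
    (fun y : ℝ => (1 - Real.cos (2 * Real.pi * y)) * |y| ^ (-1 - 2 * H)) z
  have e : ∀ y : ℝ, (1 - Real.cos (2 * Real.pi * (z * y))) * |z * y| ^ (-1 - 2 * H) =
      |z| ^ (-1 - 2 * H) *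
        ((1 - Real.cos (2 * Real.pi * (z * y))) * |y| ^ (-1 - 2 * H)) := by
    intro y
    rw [abs_mul, Real.mul_rpow hz'.le (abs_nonneg y)]; ring
  simp_rw [e] at h
  rw [integral_const_mul, smul_eq_mul, abs_inv] at h
  have hp : |z| ^ (2 * H) * |z| ^ (-1 - 2 * H) = |z|⁻¹ := by
    rw [← Real.rpow_add hz', ← Real.rpow_neg_one]; congr 1; ring
  have hne : |z| ^ (-1 - 2 * H) ≠ 0 := (Real.rpow_pos_of_pos hz' _).ne'
  apply mul_left_cancel₀ hne
  rw [h, ← hp]; ring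

/-- The covariance of the increments `B_t - B_x` and `B_t - B_y` of a fractional Brownian motion. -/
noncomputable def incrCov (H t x y : ℝ) : ℝ :=
  (|t - x| ^ (2 * H) + |t - y| ^ (2 * H) - |x - y| ^ (2 * H)) / 2

theorem incrCov_mul {H : ℝ} {c : ℝ} (hc : 0 < c) (t x y : ℝ) :
    incrCov H (c * t) (c * x) (c * y) = c ^ (2 * H) * incrCov H t x y := by
  simp only [incrCov, ← mul_sub, abs_mul, abs_of_pos hc, Real.mul_rpow hc.le (abs_nonneg _)]
  ring

theorem normSq_sum_exp_sub {ι : Type*} (s : Finset ι) (w x : ι → ℝ) (t y : ℝ) :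
    ‖∑ i ∈ s, (w i : ℂ) * (Complex.exp (↑(2 * Real.pi * (t * y)) * Complex.I) -
        Complex.exp (↑(2 * Real.pi * (x i * y)) * Complex.I))‖ ^ 2 =
      ∑ i ∈ s, ∑ j ∈ s, w i * w j * ((1 - Real.cos (2 * Real.pi * ((t - x i) * y))) +
        (1 - Real.cos (2 * Real.pi * ((t - x j) * y))) -
        (1 - Real.cos (2 * Real.pi * ((x i - x j) * y)))) := by
  rw [← Complex.normSq_eq_norm_sq, Complex.normSq_apply, Complex.re_sum, Complex.im_sum,
    Finset.sum_mul_sum, Finset.sum_mul_sum, ← Finset.sum_add_distrib]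
  refine Finset.sum_congr rfl fun i _ => ?_
  rw [← Finset.sum_add_distrib]
  refine Finset.sum_congr rfl fun j _ => ?_
  simp only [Complex.re_ofReal_mul, Complex.im_ofReal_mul, Complex.sub_re, Complex.sub_im,
    Complex.exp_ofReal_mul_I_re, Complex.exp_ofReal_mul_I_im, sub_mul, mul_sub, Real.cos_sub]
  linear_combination (w i * w j) * Real.sin_sq_add_cos_sq (2 * Real.pi * (t * y))

theorem integrable_normSq_sum_exp_sub {H : ℝ} (hH0 : 0 < H) (hH1 : H < 1) {ι : Type*}
    (s : Finset ι) (w x : ι → ℝ) (t : ℝ) :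
    Integrable fun y : ℝ =>
      ‖∑ i ∈ s, (w i : ℂ) * (Complex.exp (↑(2 * Real.pi * (t * y)) * Complex.I) -
        Complex.exp (↑(2 * Real.pi * (x i * y)) * Complex.I))‖ ^ 2 * |y| ^ (-1 - 2 * H) := by
  simp_rw [normSq_sum_exp_sub, Finset.sum_mul]
  refine integrable_finsetSum _ fun i _ => integrable_finsetSum _ fun j _ => ?_
  have h := integrable_one_sub_cos_mul_rpow hH0 hH1
  refine ((((h (t - x i)).add (h (t - x j))).sub (h (x i - x j))).const_mul (w i * w j)).congr
    (Filter.Eventually.of_forall fun y => ?_)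
  simp only [Pi.add_apply, Pi.sub_apply]
  ring

/-- Expanding the squared modulus leaves only terms `1 - cos` of differences, and each of them
integrates to a multiple of a power `|·|^{2H}`. -/
theorem integral_normSq_sum_exp_sub {H : ℝ} (hH0 : 0 < H) (hH1 : H < 1) {ι : Type*}
    (s : Finset ι) (w x : ι → ℝ) (t : ℝ) :
    ∫ y : ℝ, ‖∑ i ∈ s, (w i : ℂ) * (Complex.exp (↑(2 * Real.pi * (t * y)) * Complex.I) -
        Complex.exp (↑(2 * Real.pi * (x i * y)) * Complex.I))‖ ^ 2 * |y| ^ (-1 - 2 * H) =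
      2 * (∫ y : ℝ, (1 - Real.cos (2 * Real.pi * y)) * |y| ^ (-1 - 2 * H)) *
        ∑ i ∈ s, ∑ j ∈ s, w i * w j * incrCov H t (x i) (x j) := by
  have h := integrable_one_sub_cos_mul_rpow hH0 hH1
  have hI : ∀ i j, Integrable fun y : ℝ => w i * w j *
      ((1 - Real.cos (2 * Real.pi * ((t - x i) * y))) * |y| ^ (-1 - 2 * H) +
        (1 - Real.cos (2 * Real.pi * ((t - x j) * y))) * |y| ^ (-1 - 2 * H) -
        (1 - Real.cos (2 * Real.pi * ((x i - x j) * y))) * |y| ^ (-1 - 2 * H)) := fun i j =>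
    (((h (t - x i)).add (h (t - x j))).sub (h (x i - x j))).const_mul (w i * w j)
  have e : ∀ y : ℝ, ‖∑ i ∈ s, (w i : ℂ) * (Complex.exp (↑(2 * Real.pi * (t * y)) * Complex.I) -
        Complex.exp (↑(2 * Real.pi * (x i * y)) * Complex.I))‖ ^ 2 * |y| ^ (-1 - 2 * H) =
      ∑ i ∈ s, ∑ j ∈ s, w i * w j *
      ((1 - Real.cos (2 * Real.pi * ((t - x i) * y))) * |y| ^ (-1 - 2 * H) +
        (1 - Real.cos (2 * Real.pi * ((t - x j) * y))) * |y| ^ (-1 - 2 * H) -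
        (1 - Real.cos (2 * Real.pi * ((x i - x j) * y))) * |y| ^ (-1 - 2 * H)) := by
    intro y
    simp_rw [normSq_sum_exp_sub, Finset.sum_mul]
    refine Finset.sum_congr rfl fun i _ => Finset.sum_congr rfl fun j _ => ?_
    ring
  simp_rw [e]
  rw [integral_finsetSum _ fun i _ => integrable_finsetSum _ fun j _ => hI i j, Finset.mul_sum]
  refine Finset.sum_congr rfl fun i _ => ?_
  rw [integral_finsetSum _ fun j _ => hI i j, Finset.mul_sum]
  refine Finset.sum_congr rfl fun j _ => ?_
  rw [integral_const_mul, integral_sub (by exact (h _).add (h _)) (h _),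
    integral_add (h _) (h _)]
  simp_rw [integral_one_sub_cos_mul_rpow hH0]
  rw [incrCov]
  ring

/-- A Schwartz function is square integrable against `|y| ^ (1 + 2 * H)`. -/
theorem integrable_normSq_schwartz_mul_rpow {H : ℝ} (hH0 : 0 < H) (hH1 : H < 1)
    (ψ : SchwartzMap ℝ ℂ) : Integrable fun y : ℝ => ‖ψ y‖ ^ 2 * |y| ^ (1 + 2 * H) := by
  obtain ⟨C, hC0, hC⟩ := ψ.decay 0 0
  have h := ((ψ.integrable_pow_mul volume 0).add (ψ.integrable_pow_mul volume 3)).const_mul C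
  have hp0 : 0 ≤ 1 + 2 * H := by linarith
  refine h.mono' (by have := ψ.continuous; fun_prop) (Filter.Eventually.of_forall fun y => ?_)
  have hCy : ‖ψ y‖ ≤ C := by simpa using hC y
  have hp : |y| ^ (1 + 2 * H) ≤ 1 + |y| ^ 3 := by
    rcases le_total |y| 1 with h1 | h1
    · have := Real.rpow_le_one (abs_nonneg y) h1 (by linarith : 0 ≤ 1 + 2 * H)
      have := pow_nonneg (abs_nonneg y) 3
      linarith
    · have := Real.rpow_le_rpow_of_exponent_le h1 (by push_cast; linarith : 1 + 2 * H ≤ ((3 : ℕ) : ℝ))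
      rw [Real.rpow_natCast] at this
      linarith
  rw [Real.norm_of_nonneg (by positivity)]
  simp only [Pi.add_apply, Real.norm_eq_abs, pow_zero, one_mul]
  calc ‖ψ y‖ ^ 2 * |y| ^ (1 + 2 * H) ≤ (C * ‖ψ y‖) * (1 + |y| ^ 3) := by
        rw [sq]; gcongr
    _ = _ := by ring

/-- Strong local nondeterminism of fractional Brownian motion at unit distance. -/
theorem exists_le_sum_incrCov_of_one_le {H : ℝ} (hH0 : 0 < H) (hH1 : H < 1) :
    ∃ c : ℝ, 0 < c ∧ ∀ (ι : Type) (s : Finset ι) (w x : ι → ℝ) (t : ℝ) (i₀ : ι), i₀ ∈ s →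
      w i₀ = 1 → 1 ≤ |x i₀ - t| → (∀ i ∈ s, i ≠ i₀ → 1 ≤ |x i - x i₀|) →
      c ≤ ∑ i ∈ s, ∑ j ∈ s, w i * w j * incrCov H t (x i) (x j) := by
  obtain ⟨ψ, hψ0, hψ1⟩ := exists_schwartz_test_function
  -- The `+ 1` makes `M` positive, and the weighted norm of `ψ` divided by `M` is still at most 1.
  set M : ℝ := (∫ y : ℝ, ‖ψ y‖ ^ 2 * |y| ^ (1 + 2 * H)) + 1 with hM
  have hM0 : 0 < M := by
    have : 0 ≤ ∫ y : ℝ, ‖ψ y‖ ^ 2 * |y| ^ (1 + 2 * H) := integral_nonneg fun y => by positivity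
    linarith
  set C : ℝ := ∫ y : ℝ, (1 - Real.cos (2 * Real.pi * y)) * |y| ^ (-1 - 2 * H) with hC
  have hC0 : 0 ≤ C := integral_nonneg fun y =>
    mul_nonneg (by linarith [Real.cos_le_one (2 * Real.pi * y)]) (by positivity)
  have key : ∀ (ι : Type) (s : Finset ι) (w x : ι → ℝ) (t : ℝ) (i₀ : ι), i₀ ∈ s →
      w i₀ = 1 → 1 ≤ |x i₀ - t| → (∀ i ∈ s, i ≠ i₀ → 1 ≤ |x i - x i₀|) →
      1 ≤ M * (2 * C * ∑ i ∈ s, ∑ j ∈ s, w i * w j * incrCov H t (x i) (x j)) := by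
    intro ι s w x t i₀ hi₀ hw ht hx
    rw [← integral_normSq_sum_exp_sub hH0 hH1]
    have hI := integrable_normSq_sum_exp_sub hH0 hH1 s w x t
    set F : ℝ → ℂ := fun y => ∑ i ∈ s, (w i : ℂ) *
      (Complex.exp (↑(2 * Real.pi * (t * y)) * Complex.I) -
        Complex.exp (↑(2 * Real.pi * (x i * y)) * Complex.I)) with hF
    set I : ℝ := ∫ y : ℝ, ‖F y‖ ^ 2 * |y| ^ (-1 - 2 * H) with hIdef
    have hexp : ∀ z : ℝ, Integrable fun y =>
        Complex.exp (↑(2 * Real.pi * (z * y)) * Complex.I) * ψ y := fun z => by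
      refine (ψ.integrable (μ := volume)).norm.mono' (by have := ψ.continuous; fun_prop)
        (Filter.Eventually.of_forall fun y => ?_)
      rw [norm_mul, Complex.norm_exp_ofReal_mul_I, one_mul]
    -- After modulation by `-x i₀`, integration against `ψ` evaluates the bump at `t - x i₀` and at
    -- `x i - x i₀`. Separation kills every value except the one at 0, which carries the coefficient
    -- `-w i₀`.
    have e1 : ∫ y, (Complex.exp (↑(2 * Real.pi * ((-x i₀) * y)) * Complex.I) * F y) * ψ y = -1 := by
      have e2 : ∀ y, (Complex.exp (↑(2 * Real.pi * ((-x i₀) * y)) * Complex.I) * F y) * ψ y =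
          ∑ i ∈ s, (w i : ℂ) *
            (Complex.exp (↑(2 * Real.pi * ((t - x i₀) * y)) * Complex.I) * ψ y -
              Complex.exp (↑(2 * Real.pi * ((x i - x i₀) * y)) * Complex.I) * ψ y) := by
        intro y
        simp only [hF]
        rw [Finset.mul_sum, Finset.sum_mul]
        refine Finset.sum_congr rfl fun i _ => ?_
        have a1 : ∀ u : ℝ, Complex.exp (↑(2 * Real.pi * ((u - x i₀) * y)) * Complex.I) =
            Complex.exp (↑(2 * Real.pi * ((-x i₀) * y)) * Complex.I) *
              Complex.exp (↑(2 * Real.pi * (u * y)) * Complex.I) := by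
          intro u; rw [← Complex.exp_add]; congr 1; push_cast; ring
        rw [a1 t, a1 (x i)]; ring
      simp_rw [e2]
      rw [integral_finsetSum _ fun i _ => by exact ((hexp _).sub (hexp _)).const_mul _,
        Finset.sum_eq_single_of_mem i₀ hi₀]
      · rw [integral_const_mul, integral_sub (hexp _) (hexp _),
          hψ1 (t - x i₀) (by rwa [abs_sub_comm]), sub_self, hψ0, hw]
        simp
      · intro i hi hne
        rw [integral_const_mul, integral_sub (hexp _) (hexp _),
          hψ1 (t - x i₀) (by rwa [abs_sub_comm]), hψ1 _ (hx i hi hne)]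
        simp
    have hψI := integrable_normSq_schwartz_mul_rpow hH0 hH1 ψ
    have h2 : (1 : ℝ) ≤ ∫ y, ‖F y‖ * ‖ψ y‖ := by
      have := norm_integral_le_integral_norm (μ := volume)
        fun y => (Complex.exp (↑(2 * Real.pi * ((-x i₀) * y)) * Complex.I) * F y) * ψ y
      rw [e1] at this
      simpa only [norm_mul, Complex.norm_exp_ofReal_mul_I, one_mul, norm_neg, norm_one] using this
    -- Cauchy–Schwarz in the form of a weighted arithmetic-geometric mean inequality, with weight `p
    -- = |y|^{1+2H}`.
    have h3 : ∫ y, ‖F y‖ * ‖ψ y‖ ≤ ∫ y, (M * (‖F y‖ ^ 2 * |y| ^ (-1 - 2 * H)) +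
        M⁻¹ * (‖ψ y‖ ^ 2 * |y| ^ (1 + 2 * H))) / 2 := by
      refine integral_mono_of_nonneg (Filter.Eventually.of_forall fun y => by positivity)
        (((hI.const_mul M).add (hψI.const_mul M⁻¹)).div_const 2) ?_
      have h0 : ∀ᵐ y : ℝ, y ≠ 0 := by simp [ae_iff]
      filter_upwards [h0] with y hy
      have hy' : 0 < |y| := abs_pos.2 hy
      set p := |y| ^ (1 + 2 * H) with hp
      have hp0 : 0 < p := Real.rpow_pos_of_pos hy' _
      have hpi : |y| ^ (-1 - 2 * H) = p⁻¹ := by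
        rw [hp, ← Real.rpow_neg hy'.le]; congr 1; ring
      have hmp : 0 < M * p := mul_pos hM0 hp0
      rw [hpi]
      set a := ‖F y‖
      set b := ‖ψ y‖
      have : (M * (a ^ 2 * p⁻¹) + M⁻¹ * (b ^ 2 * p)) / 2 - a * b =
          (M * a - b * p) ^ 2 / (2 * (M * p)) := by
        field_simp; ring
      have h4 : 0 ≤ (M * a - b * p) ^ 2 / (2 * (M * p)) := by positivity
      linarith
    rw [integral_div, integral_add (hI.const_mul M) (hψI.const_mul M⁻¹), integral_const_mul,
      integral_const_mul] at h3
    have h5 : M⁻¹ * ∫ y : ℝ, ‖ψ y‖ ^ 2 * |y| ^ (1 + 2 * H) ≤ 1 := by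
      rw [inv_mul_le_iff₀ hM0]; linarith
    linarith
  -- Were `C` zero, the inequality just proved, for a single point at distance 1 from `t`, would
  -- read `1 ≤ 0`.
  have hCpos : 0 < C := by
    rcases hC0.eq_or_lt with h | h
    · have := key Unit {()} (fun _ => 1) (fun _ => 1) 0 () (by simp) rfl (by simp) (by simp)
      rw [← h] at this
      simp at this
      linarith
    · exact h
  refine ⟨1 / (M * (2 * C)), by positivity, fun ι s w x t i₀ hi₀ hw ht hx => ?_⟩
  rw [div_le_iff₀ (by positivity)]
  have := key ι s w x t i₀ hi₀ hw ht hx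
  linarith

/-- Strong local nondeterminism of fractional Brownian motion. -/
theorem exists_le_sum_incrCov {H : ℝ} (hH0 : 0 < H) (hH1 : H < 1) :
    ∃ c : ℝ, 0 < c ∧ ∀ (ι : Type) (s : Finset ι) (w x : ι → ℝ) (t ρ : ℝ) (i₀ : ι), i₀ ∈ s →
      w i₀ = 1 → 0 < ρ → ρ ≤ |x i₀ - t| → (∀ i ∈ s, i ≠ i₀ → ρ ≤ |x i - x i₀|) →
      c * ρ ^ (2 * H) ≤ ∑ i ∈ s, ∑ j ∈ s, w i * w j * incrCov H t (x i) (x j) := by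
  obtain ⟨c, hc, h⟩ := exists_le_sum_incrCov_of_one_le hH0 hH1
  refine ⟨c, hc, fun ι s w x t ρ i₀ hi₀ hw hρ ht hx => ?_⟩
  have hs : ∀ u v : ℝ, ρ ≤ |u - v| → 1 ≤ |u / ρ - v / ρ| := fun u v huv => by
    rw [← sub_div, abs_div, abs_of_pos hρ, le_div_iff₀ hρ, one_mul]; exact huv
  -- The quadratic form is homogeneous of degree `2H` under dilations, so dividing all points by `ρ`
  -- reduces to unit distance.
  have h1 := h ι s w (fun i => x i / ρ) (t / ρ) i₀ hi₀ hw (hs _ _ ht)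
    fun i hi hne => hs _ _ (hx i hi hne)
  have h2 : ∀ i j, incrCov H t (x i) (x j) =
      ρ ^ (2 * H) * incrCov H (t / ρ) (x i / ρ) (x j / ρ) := fun i j => by
    rw [← incrCov_mul hρ]; congr 1 <;> field_simp
  simp_rw [h2]
  have h3 : ∑ i ∈ s, ∑ j ∈ s, w i * w j *
      (ρ ^ (2 * H) * incrCov H (t / ρ) (x i / ρ) (x j / ρ)) =
      (∑ i ∈ s, ∑ j ∈ s, w i * w j * incrCov H (t / ρ) (x i / ρ) (x j / ρ)) * ρ ^ (2 * H) := by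
    rw [Finset.sum_mul]
    refine Finset.sum_congr rfl fun i _ => ?_
    rw [Finset.sum_mul]
    exact Finset.sum_congr rfl fun j _ => by ring
  rw [h3]
  exact mul_le_mul_of_nonneg_right h1 (by positivity)

/-! ### Gaussian subspaces of `L²`: closedness and independence. -/

/-- `f ∈ L²` satisfies the characteristic function identity of a centred Gaussian variable. -/
def IsCenteredGaussianL2 {Ω : Type*} [MeasurableSpace Ω] {P : Measure Ω} (f : Lp ℝ 2 P) : Prop :=
  ∀ s : ℝ, ∫ ω, Complex.exp (s * f ω * Complex.I) ∂P = Complex.exp (-(s ^ 2 * ‖f‖ ^ 2 / 2 : ℝ))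

section

variable {Ω : Type*} [MeasurableSpace Ω] {P : Measure Ω}

theorem integral_norm_le_norm_L2 [IsProbabilityMeasure P] (f : Lp ℝ 2 P) :
    ∫ ω, ‖f ω‖ ∂P ≤ ‖f‖ := by
  have h := eLpNorm_le_eLpNorm_of_exponent_le (μ := P) (p := 1) (q := 2) (by norm_num)
    (Lp.aestronglyMeasurable f)
  rw [integral_norm_eq_lintegral_enorm (Lp.aestronglyMeasurable f), Lp.norm_def,
    ← eLpNorm_one_eq_lintegral_enorm]
  exact ENNReal.toReal_mono (Lp.eLpNorm_ne_top f) h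

/-- Since `|e^{iu} - e^{iv}| ≤ |u - v|`, the map is `|s|`-Lipschitz already for the `L¹` norm. This
is what carries Gaussianity to closed spans. -/
theorem continuous_integral_exp_mul_I [IsProbabilityMeasure P] (s : ℝ) :
    Continuous fun f : Lp ℝ 2 P => ∫ ω, Complex.exp (s * f ω * Complex.I) ∂P := by
  have hI : ∀ f : Lp ℝ 2 P, Integrable (fun ω => Complex.exp (s * f ω * Complex.I)) P := by
    intro f
    refine Integrable.of_bound (C := 1) ?_ (Filter.Eventually.of_forall fun ω => ?_)
    · have := Lp.aestronglyMeasurable f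
      fun_prop
    · rw [← Complex.ofReal_mul, Complex.norm_exp_ofReal_mul_I]
  refine (LipschitzWith.of_dist_le_mul (K := ⟨|s|, abs_nonneg s⟩) fun f g => ?_).continuous
  rw [dist_eq_norm, ← integral_sub (hI f) (hI g), dist_eq_norm]
  have h1 : ∀ᵐ ω ∂P, ‖Complex.exp (s * f ω * Complex.I) - Complex.exp (s * g ω * Complex.I)‖ ≤
      |s| * ‖(f - g) ω‖ := by
    filter_upwards [Lp.coeFn_sub f g] with ω hω
    rw [hω, Pi.sub_apply]
    have h2 : Complex.exp (s * f ω * Complex.I) - Complex.exp (s * g ω * Complex.I) =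
        Complex.exp (↑(s * g ω) * Complex.I) *
          (Complex.exp (Complex.I * ↑(s * (f ω - g ω))) - 1) := by
      rw [mul_sub, ← Complex.exp_add, mul_one]; congr 2 <;> push_cast <;> ring
    rw [h2, norm_mul, Complex.norm_exp_ofReal_mul_I, one_mul]
    refine (Real.norm_exp_I_mul_ofReal_sub_one_le).trans ?_
    rw [norm_mul, Real.norm_eq_abs s]
  calc _ ≤ ∫ ω, ‖Complex.exp (s * f ω * Complex.I) - Complex.exp (s * g ω * Complex.I)‖ ∂P :=
        norm_integral_le_integral_norm _
    _ ≤ ∫ ω, |s| * ‖(f - g) ω‖ ∂P :=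
        integral_mono_ae ((hI f).sub (hI g)).norm
          (((Lp.memLp (f - g)).integrable (by norm_num)).norm.const_mul _) h1
    _ ≤ |s| * ‖f - g‖ := by
        rw [integral_const_mul]
        exact mul_le_mul_of_nonneg_left (integral_norm_le_norm_L2 _) (abs_nonneg s)

theorem isClosed_isCenteredGaussianL2 [IsProbabilityMeasure P] :
    IsClosed {f : Lp ℝ 2 P | IsCenteredGaussianL2 f} := by
  simp only [IsCenteredGaussianL2, Set.ofPred_forall]
  refine isClosed_iInter fun s => isClosed_eq (continuous_integral_exp_mul_I s) (by fun_prop)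

theorem IsCenteredGaussianL2.map_eq [IsProbabilityMeasure P] {f : Lp ℝ 2 P}
    (hf : IsCenteredGaussianL2 f) : P.map f = gaussianReal 0 (‖f‖₊ ^ 2) := by
  have hm : AEMeasurable f P := (Lp.aestronglyMeasurable f).aemeasurable
  have := Measure.isProbabilityMeasure_map hm
  refine Measure.ext_of_charFun (funext fun s => ?_)
  rw [charFun_gaussianReal, charFun_apply_real, integral_map hm (by fun_prop)]
  refine (hf s).trans ?_
  congr 1
  push_cast
  simp
  ring

theorem IsCenteredGaussianL2.hasGaussianLaw [IsProbabilityMeasure P] {f : Lp ℝ 2 P}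
    (hf : IsCenteredGaussianL2 f) : HasGaussianLaw f P :=
  ⟨by rw [hf.map_eq]; infer_instance⟩

theorem IsCenteredGaussianL2.integral_eq_zero [IsProbabilityMeasure P] {f : Lp ℝ 2 P}
    (hf : IsCenteredGaussianL2 f) : ∫ ω, f ω ∂P = 0 := by
  have hm : AEMeasurable f P := (Lp.aestronglyMeasurable f).aemeasurable
  have h := integral_map (μ := P) hm (f := fun x : ℝ => x) (by fun_prop)
  rw [← h, hf.map_eq, integral_id_gaussianReal]

theorem isCenteredGaussianL2_of_hasGaussianLaw [IsProbabilityMeasure P] {f : Lp ℝ 2 P}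
    (hf : HasGaussianLaw f P) (h0 : ∫ ω, f ω ∂P = 0) : IsCenteredGaussianL2 f := by
  intro s
  have hm : AEMeasurable f P := (Lp.aestronglyMeasurable f).aemeasurable
  have h1 : charFun (P.map f) s = ∫ ω, Complex.exp (s * f ω * Complex.I) ∂P := by
    rw [charFun_apply_real, integral_map hm (by fun_prop)]
  have hv : Var[f; P] = ‖f‖ ^ 2 := by
    rw [variance_of_integral_eq_zero hm h0, ← real_inner_self_eq_norm_sq, L2.inner_def]
    simp [inner, sq]
  rw [← h1, hf.map_eq_gaussianReal, charFun_gaussianReal, h0, hv]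
  congr 1
  rw [Real.coe_toNNReal _ (by positivity)]
  push_cast
  ring

/-- A linear subspace of `L²` consisting of centred Gaussian variables is a Gaussian process. -/
theorem isGaussianProcess_submodule [IsProbabilityMeasure P] {G : Submodule ℝ (Lp ℝ 2 P)}
    (hG : ∀ f ∈ G, IsCenteredGaussianL2 f) :
    IsGaussianProcess (fun (f : G) => ((f : Lp ℝ 2 P) : Ω → ℝ)) P := by
  refine ⟨fun I => ⟨⟨fun L => ?_⟩⟩⟩
  set X : Ω → (I → ℝ) := fun ω => I.restrict fun f : G => (f : Lp ℝ 2 P) ω with hX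
  have hXm : AEMeasurable X P :=
    aemeasurable_pi_lambda _ fun f => (Lp.aestronglyMeasurable ((f : G) : Lp ℝ 2 P)).aemeasurable
  classical
  let g : G := ∑ i : I, L (Pi.single i 1) • (i : G)
  have hg : (L ∘ X) =ᵐ[P] ((g : Lp ℝ 2 P) : Ω → ℝ) := by
    have h1 : ((g : Lp ℝ 2 P) : Ω → ℝ) =ᵐ[P]
        ∑ i : I, ((L (Pi.single i 1) • ((i : G) : Lp ℝ 2 P) : Lp ℝ 2 P) : Ω → ℝ) := by
      have : (g : Lp ℝ 2 P) = ∑ i : I, L (Pi.single i 1) • ((i : G) : Lp ℝ 2 P) := by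
        simp [g]
      rw [this]
      exact Lp.coeFn_finsetSum _ _
    have h2 : ∀ᵐ ω ∂P, ∀ i : I,
        ((L (Pi.single i 1) • ((i : G) : Lp ℝ 2 P) : Lp ℝ 2 P) : Ω → ℝ) ω =
          L (Pi.single i 1) * ((i : G) : Lp ℝ 2 P) ω := by
      rw [ae_all_iff]
      intro i
      filter_upwards [Lp.coeFn_smul (L (Pi.single i 1)) ((i : G) : Lp ℝ 2 P)] with ω hω
      simpa using hω
    filter_upwards [h1, h2] with ω hω1 hω2
    rw [hω1, Finset.sum_apply]
    simp_rw [hω2]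
    have h3 : X ω = ∑ i : I, X ω i • Pi.single (M := fun _ : I => ℝ) i (1 : ℝ) := by
      ext j; simp [Finset.sum_apply, Pi.single_apply]
    rw [Function.comp_apply, h3, map_sum]
    refine Finset.sum_congr rfl fun i _ => ?_
    rw [map_smul, smul_eq_mul, mul_comm]
    rfl
  have hL : HasGaussianLaw (L ∘ X) P := ((hG g g.2).hasGaussianLaw).congr hg.symm
  have h4 : (P.map X).map L = P.map (L ∘ X) :=
    AEMeasurable.map_map_of_aemeasurable (by fun_prop) hXm
  rw [h4, hL.map_eq_gaussianReal, integral_map hXm (by fun_prop),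
    variance_map (by fun_prop) hXm]
  rfl

theorem covariance_eq_inner_L2 [IsProbabilityMeasure P] {f g : Lp ℝ 2 P}
    (hf : IsCenteredGaussianL2 f) :
    cov[f, g; P] = inner ℝ f g := by
  rw [covariance_eq_sub (Lp.memLp f) (Lp.memLp g), hf.integral_eq_zero, L2.inner_def]
  simp [inner, mul_comm]

/-- Orthogonal families in a Gaussian subspace are independent. -/
theorem indepFun_of_inner_eq_zero [IsProbabilityMeasure P] {G : Submodule ℝ (Lp ℝ 2 P)}
    (hG : ∀ f ∈ G, IsCenteredGaussianL2 f) {S T : Type*} {f : S → Lp ℝ 2 P} {g : T → Lp ℝ 2 P}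
    (hf : ∀ s, f s ∈ G) (hg : ∀ t, g t ∈ G) (h : ∀ s t, inner ℝ (f s) (g t) = 0) :
    IndepFun (fun ω s => f s ω) (fun ω t => g t ω) P := by
  refine IsGaussianProcess.indepFun_of_covariance_eq_zero
    (X := fun s => (f s : Ω → ℝ)) (Y := fun t => (g t : Ω → ℝ)) ?_
    (fun s => (Lp.aestronglyMeasurable (f s)).aemeasurable)
    (fun t => (Lp.aestronglyMeasurable (g t)).aemeasurable) fun s t => ?_
  · have := (isGaussianProcess_submodule hG).comp_right
      (Sum.elim (fun s => (⟨f s, hf s⟩ : G)) (fun t => ⟨g t, hg t⟩))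
    have e : Sum.elim (fun s => (f s : Ω → ℝ)) (fun t => (g t : Ω → ℝ)) =
        (fun f : G => ((f : Lp ℝ 2 P) : Ω → ℝ)) ∘
          Sum.elim (fun s => (⟨f s, hf s⟩ : G)) (fun t => ⟨g t, hg t⟩) := by
      funext u; cases u <;> rfl
    rw [e]
    exact this
  · rw [covariance_eq_inner_L2 (hG _ (hf s)), h]

/-- A pairwise orthogonal family in a Gaussian subspace is independent. -/
theorem iIndepFun_of_inner_eq_zero [IsProbabilityMeasure P] {G : Submodule ℝ (Lp ℝ 2 P)}
    (hG : ∀ f ∈ G, IsCenteredGaussianL2 f) {S : Type*} {f : S → Lp ℝ 2 P}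
    (hf : ∀ s, f s ∈ G) (h : ∀ s t, s ≠ t → inner ℝ (f s) (f t) = 0) :
    iIndepFun (fun s ω => f s ω) P := by
  have h1 := IsGaussianProcess.iIndepFun_of_covariance_eq_zero (P := P)
    (X := fun (s : S) (_ : Unit) => (f s : Ω → ℝ))
    ((isGaussianProcess_submodule hG).comp_right fun p : (_ : S) × Unit => (⟨f p.1, hf p.1⟩ : G))
    (fun s _ => (Lp.aestronglyMeasurable (f s)).aemeasurable)
    (fun s t hst _ _ => by rw [covariance_eq_inner_L2 (hG _ (hf s)), h s t hst])
  exact h1.comp (fun _ x => x ()) (fun _ => measurable_pi_apply ())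

/-- The closed linear span of a centred Gaussian process consists of centred Gaussian variables. -/
theorem isCenteredGaussianL2_of_mem_closure_span [IsProbabilityMeasure P] {T : Type*}
    {X : T → Ω → ℝ} (hX : IsGaussianProcess X P) (h0 : ∀ t, ∫ ω, X t ω ∂P = 0)
    {b : T → Lp ℝ 2 P} (hb : ∀ t, b t =ᵐ[P] X t) :
    ∀ f ∈ (Submodule.span ℝ (Set.range b)).topologicalClosure, IsCenteredGaussianL2 f := by
  have hbG : IsGaussianProcess (fun t => (b t : Ω → ℝ)) P := hX.congr fun t => (hb t).symm
  have h0' : ∀ t, ∫ ω, b t ω ∂P = 0 := fun t => by rw [integral_congr_ae (hb t), h0]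
  refine fun f hf => closure_minimal (fun f hf => ?_) isClosed_isCenteredGaussianL2 hf
  obtain ⟨c, rfl⟩ := (Finsupp.mem_span_range_iff_exists_finsupp).1 hf
  have he : (c.sum fun t a => a • b t : Lp ℝ 2 P) =ᵐ[P] fun ω => ∑ t ∈ c.support, c t * b t ω := by
    have h1 : (c.sum fun t a => a • b t : Lp ℝ 2 P) =ᵐ[P]
        ∑ t ∈ c.support, ((c t • b t : Lp ℝ 2 P) : Ω → ℝ) := Lp.coeFn_finsetSum _ _
    have h2 : ∀ᵐ ω ∂P, ∀ t ∈ c.support, ((c t • b t : Lp ℝ 2 P) : Ω → ℝ) ω = c t * b t ω := by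
      rw [Finset.eventually_all]
      intro t _
      filter_upwards [Lp.coeFn_smul (c t) (b t)] with ω hω
      simpa using hω
    filter_upwards [h1, h2] with ω hω1 hω2
    rw [hω1, Finset.sum_apply]
    exact Finset.sum_congr rfl hω2
  refine isCenteredGaussianL2_of_hasGaussianLaw ?_ ?_
  · refine HasGaussianLaw.congr ?_ he.symm
    have := (hbG.smul fun t => c t).hasGaussianLaw_fun_sum (I := c.support)
    simpa using this
  · rw [integral_congr_ae he, integral_finsetSum]
    · simp [integral_const_mul, h0']
    · exact fun t _ => ((Lp.memLp (b t)).integrable (by norm_num)).const_mul _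

end

/-! ### Integrating a Gaussian weight over an independent residual. -/

/-- The integrand is at most 1, and the density is at most `(2πv)^{-1/2}` while the Lebesgue
integral is `√(πq)`. Uniformity in the shift `m` matters: `m` will be the prediction from the other
increments. -/
theorem lintegral_exp_neg_sq_div_gaussianReal_le {q : ℝ} (hq : 0 < q) {v : ℝ≥0} (hv : v ≠ 0)
    (m : ℝ) :
    ∫⁻ x, ENNReal.ofReal (Real.exp (-((m + x) ^ 2 / q))) ∂(gaussianReal 0 v) ≤
      ENNReal.ofReal (min 1 √(q / (2 * v))) := by
  have hv' : (0 : ℝ) < v := by exact_mod_cast pos_iff_ne_zero.2 hv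
  rw [ENNReal.ofReal_min, le_min_iff]
  constructor
  · calc ∫⁻ x, ENNReal.ofReal (Real.exp (-((m + x) ^ 2 / q))) ∂(gaussianReal 0 v)
        ≤ ∫⁻ _, 1 ∂(gaussianReal 0 v) := by
          refine lintegral_mono fun x => ?_
          rw [← ENNReal.ofReal_one]
          refine ENNReal.ofReal_le_ofReal (Real.exp_le_one_iff.2 ?_)
          have : 0 ≤ (m + x) ^ 2 / q := by positivity
          linarith
      _ = ENNReal.ofReal 1 := by simp
  · have hI : Integrable fun x : ℝ => Real.exp (-((m + x) ^ 2 / q)) := by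
      have h := (integrable_exp_neg_mul_sq (b := q⁻¹) (by positivity)).comp_add_left m
      refine h.congr (Filter.Eventually.of_forall fun x => ?_)
      simp only
      congr 1; rw [div_eq_mul_inv]; ring
    have hG : ∫ x : ℝ, Real.exp (-((m + x) ^ 2 / q)) = √(Real.pi * q) := by
      have h := integral_gaussian q⁻¹
      rw [← integral_add_left_eq_self _ m, div_inv_eq_mul] at h
      rw [← h]
      congr 1; ext x; congr 1; rw [div_eq_mul_inv]; ring
    rw [gaussianReal_of_var_ne_zero 0 hv,
      lintegral_withDensity_eq_lintegral_mul₀ (by fun_prop) (by fun_prop)]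
    calc ∫⁻ x, (gaussianPDF 0 v * fun x => ENNReal.ofReal (Real.exp (-((m + x) ^ 2 / q)))) x
        ≤ ∫⁻ x, ENNReal.ofReal ((√(2 * Real.pi * v))⁻¹ * Real.exp (-((m + x) ^ 2 / q))) := by
          refine lintegral_mono fun x => ?_
          simp only [Pi.mul_apply, gaussianPDF]
          rw [← ENNReal.ofReal_mul (gaussianPDFReal_nonneg _ _ _)]
          refine ENNReal.ofReal_le_ofReal (mul_le_mul_of_nonneg_right ?_ (Real.exp_pos _).le)
          rw [gaussianPDFReal]
          refine mul_le_of_le_one_right (by positivity) (Real.exp_le_one_iff.2 ?_)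
          have : 0 ≤ (x - 0) ^ 2 / (2 * (v : ℝ)) := by positivity
          rw [neg_div]; linarith
      _ = ENNReal.ofReal √(q / (2 * v)) := by
          rw [← ofReal_integral_eq_lintegral_ofReal (hI.const_mul _)
            (Filter.Eventually.of_forall fun x => by positivity), integral_const_mul, hG,
            ← Real.sqrt_inv, ← Real.sqrt_mul (by positivity)]
          congr 2
          field_simp

section

variable {Ω : Type*} [MeasurableSpace Ω] {P : Measure Ω}

/-- Conditionally on the past, the Gaussian weight of a new variable with residual variance `v` is
at most `min 1 √(q / (2 v))` per coordinate. -/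
theorem lintegral_mul_prod_exp_le [IsProbabilityMeasure P] {G : Submodule ℝ (Lp ℝ 2 P)}
    (hG : ∀ f ∈ G, IsCenteredGaussianL2 f) {T : Type*} {d : ℕ} {f : T → Lp ℝ 2 P}
    {R : Fin d → Lp ℝ 2 P} (hf : ∀ t, f t ∈ G) (hR : ∀ i, R i ∈ G)
    (hRf : ∀ i t, inner ℝ (R i) (f t) = 0) (hRR : ∀ i j, i ≠ j → inner ℝ (R i) (R j) = 0)
    {v : ℝ≥0} (hv : v ≠ 0) (hRv : ∀ i, ‖R i‖₊ ^ 2 = v) {q : ℝ} (hq : 0 < q)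
    {Φ : (T → ℝ) → ℝ≥0∞} (hΦ : Measurable Φ) {m : Fin d → (T → ℝ) → ℝ}
    (hm : ∀ i, Measurable (m i)) :
    ∫⁻ ω, Φ (fun t => f t ω) *
        ∏ i, ENNReal.ofReal (Real.exp (-((m i (fun t => f t ω) + R i ω) ^ 2 / q))) ∂P ≤
      ENNReal.ofReal (min 1 √(q / (2 * v))) ^ d * ∫⁻ ω, Φ (fun t => f t ω) ∂P := by
  have hfm : Measurable fun ω (t : T) => f t ω :=
    measurable_pi_lambda _ fun t => (Lp.stronglyMeasurable (f t)).measurable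
  have hRm : Measurable fun ω (i : Fin d) => R i ω :=
    measurable_pi_lambda _ fun i => (Lp.stronglyMeasurable (R i)).measurable
  have hind : IndepFun (fun ω (i : Fin d) => R i ω) (fun ω (t : T) => f t ω) P :=
    indepFun_of_inner_eq_zero hG hR hf hRf
  have hlaw := (indepFun_iff_map_prod_eq_prod_map_map hfm.aemeasurable hRm.aemeasurable).1
    hind.symm
  have := Measure.isProbabilityMeasure_map (μ := P) hfm.aemeasurable
  have := Measure.isProbabilityMeasure_map (μ := P) hRm.aemeasurable
  set F : (T → ℝ) × (Fin d → ℝ) → ℝ≥0∞ := fun p => Φ p.1 *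
    ∏ i, ENNReal.ofReal (Real.exp (-((m i p.1 + p.2 i) ^ 2 / q))) with hF
  have hFm : Measurable F := by
    refine (hΦ.comp measurable_fst).mul (Finset.measurable_prod _ fun i _ => ?_)
    have := hm i
    fun_prop
  have h1 : ∫⁻ ω, Φ (fun t => f t ω) *
        ∏ i, ENNReal.ofReal (Real.exp (-((m i (fun t => f t ω) + R i ω) ^ 2 / q))) ∂P =
      ∫⁻ x, ∫⁻ y, F (x, y) ∂(P.map fun ω (i : Fin d) => R i ω) ∂(P.map fun ω t => f t ω) := by
    rw [← lintegral_prod _ hFm.aemeasurable, ← hlaw, lintegral_map hFm (hfm.prodMk hRm)]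
  -- With the values `x` of the conditioning family frozen, only the independent residuals are
  -- integrated, one coordinate at a time.
  have h2 : ∀ x : T → ℝ, ∫⁻ y, F (x, y) ∂(P.map fun ω (i : Fin d) => R i ω) ≤
      ENNReal.ofReal (min 1 √(q / (2 * v))) ^ d * Φ x := by
    intro x
    rw [lintegral_map (f := fun y => F (x, y)) (hFm.comp measurable_prodMk_left) hRm]
    simp only [hF]
    have hgm : ∀ i, Measurable fun r : ℝ => ENNReal.ofReal (Real.exp (-((m i x + r) ^ 2 / q))) :=
      fun i => by fun_prop
    have hpm : Measurable fun ω => ∏ i, ENNReal.ofReal (Real.exp (-((m i x + R i ω) ^ 2 / q))) :=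
      Finset.measurable_prod _ fun i _ => (hgm i).comp (Lp.stronglyMeasurable (R i)).measurable
    rw [lintegral_const_mul _ hpm, mul_comm]
    refine mul_le_mul_left ?_ _
    have hii := (iIndepFun_of_inner_eq_zero hG hR hRR).comp _ hgm
    have h3 := lintegral_prod_eq_prod_lintegral_of_indepFun Finset.univ _ hii
      fun i => (hgm i).comp (Lp.stronglyMeasurable (R i)).measurable
    simp only [Function.comp_apply] at h3
    rw [h3]
    refine (Finset.prod_le_prod' (g := fun _ => ENNReal.ofReal (min 1 √(q / (2 * v))))
      fun i _ => ?_).trans (by simp)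
    have h4 := lintegral_map (μ := P) (hgm i) (Lp.stronglyMeasurable (R i)).measurable
    rw [← h4, (hG _ (hR i)).map_eq, hRv i]
    exact lintegral_exp_neg_sq_div_gaussianReal_le hq hv _
  rw [h1]
  refine (lintegral_mono h2).trans ?_
  rw [lintegral_const_mul _ hΦ, lintegral_map hΦ hfm]

/-! ### The Gaussian space of fractional Brownian motion. -/

namespace IsFractionalBrownianMotion

variable {d : ℕ} {H : ℝ} {B : ℝ≥0 → Ω → EuclideanSpace ℝ (Fin d)}

theorem isGaussianProcess_coord (hB : IsFractionalBrownianMotion P H B) :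
    IsGaussianProcess (fun (p : ℝ≥0 × Fin d) ω => B p.1 ω p.2) P :=
  (hB.gaussian.comp_right Prod.fst).comp_left fun p : ℝ≥0 × Fin d =>
    (EuclideanSpace.proj p.2 : EuclideanSpace ℝ (Fin d) →L[ℝ] ℝ)

theorem memLp_coord (hB : IsFractionalBrownianMotion P H B) (p : ℝ≥0 × Fin d) :
    MemLp (fun ω => B p.1 ω p.2) 2 P :=
  (hB.isGaussianProcess_coord.hasGaussianLaw_eval p).memLp_two

theorem integrable (hB : IsFractionalBrownianMotion P H B) (t : ℝ≥0) : Integrable (B t) P :=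
  (hB.gaussian.hasGaussianLaw_eval t).integrable

/-- The coordinates of a fractional Brownian motion as elements of `L²`. -/
noncomputable def coordL2 (hB : IsFractionalBrownianMotion P H B) (p : ℝ≥0 × Fin d) : Lp ℝ 2 P :=
  (hB.memLp_coord p).toLp _

theorem coordL2_ae_eq (hB : IsFractionalBrownianMotion P H B) (p : ℝ≥0 × Fin d) :
    hB.coordL2 p =ᵐ[P] fun ω => B p.1 ω p.2 :=
  (hB.memLp_coord p).coeFn_toLp

/-- The Gaussian space of a fractional Brownian motion. -/
noncomputable def gaussianSpace (hB : IsFractionalBrownianMotion P H B) : Submodule ℝ (Lp ℝ 2 P) :=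
  (Submodule.span ℝ (Set.range hB.coordL2)).topologicalClosure

theorem isCenteredGaussianL2 [IsProbabilityMeasure P] (hB : IsFractionalBrownianMotion P H B) :
    ∀ f ∈ hB.gaussianSpace, IsCenteredGaussianL2 f :=
  isCenteredGaussianL2_of_mem_closure_span hB.isGaussianProcess_coord
    (fun p => hB.mean_zero p.1 p.2) hB.coordL2_ae_eq

theorem coordL2_mem (hB : IsFractionalBrownianMotion P H B) (p : ℝ≥0 × Fin d) :
    hB.coordL2 p ∈ hB.gaussianSpace :=
  Submodule.le_topologicalClosure _ (Submodule.subset_span ⟨p, rfl⟩)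

theorem inner_coordL2 (hB : IsFractionalBrownianMotion P H B) (t s : ℝ≥0) (i j : Fin d) :
    inner ℝ (hB.coordL2 (t, i)) (hB.coordL2 (s, j)) =
      if i = j then
        ((t : ℝ) ^ (2 * H) + (s : ℝ) ^ (2 * H) - |(t : ℝ) - (s : ℝ)| ^ (2 * H)) / 2
      else 0 := by
  rw [← hB.covariance, L2.inner_def]
  refine integral_congr_ae ?_
  filter_upwards [hB.coordL2_ae_eq (t, i), hB.coordL2_ae_eq (s, j)] with ω h1 h2
  rw [h1, h2]
  simp [inner, mul_comm]

/-- The increment `B_t - B_x` of one coordinate. -/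
noncomputable def incrL2 (hB : IsFractionalBrownianMotion P H B) (t x : ℝ≥0) (i : Fin d) :
    Lp ℝ 2 P :=
  hB.coordL2 (t, i) - hB.coordL2 (x, i)

theorem incrL2_mem (hB : IsFractionalBrownianMotion P H B) (t x : ℝ≥0) (i : Fin d) :
    hB.incrL2 t x i ∈ hB.gaussianSpace :=
  sub_mem (hB.coordL2_mem _) (hB.coordL2_mem _)

theorem incrL2_ae_eq (hB : IsFractionalBrownianMotion P H B) (t x : ℝ≥0) (i : Fin d) :
    hB.incrL2 t x i =ᵐ[P] fun ω => B t ω i - B x ω i := by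
  filter_upwards [hB.coordL2_ae_eq (t, i), hB.coordL2_ae_eq (x, i),
    Lp.coeFn_sub (hB.coordL2 (t, i)) (hB.coordL2 (x, i))] with ω h1 h2 h3
  rw [incrL2, h3, Pi.sub_apply, h1, h2]

theorem inner_incrL2 (hB : IsFractionalBrownianMotion P H B) (hH : 0 < H) (t x y : ℝ≥0)
    (i j : Fin d) :
    inner ℝ (hB.incrL2 t x i) (hB.incrL2 t y j) = if i = j then incrCov H t x y else 0 := by
  simp only [incrL2, inner_sub_left, inner_sub_right, inner_coordL2, incrCov]
  split_ifs with h
  · rw [sub_self, abs_zero, Real.zero_rpow (by linarith), abs_sub_comm (x : ℝ) t]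
    ring
  · simp

end IsFractionalBrownianMotion

end

/-! ### Adding one point to a product of Gaussian weights. -/

theorem ofReal_exp_neg_norm_sq_div {d : ℕ} (y : EuclideanSpace ℝ (Fin d)) (q : ℝ) :
    ENNReal.ofReal (Real.exp (-(‖y‖ ^ 2 / q))) =
      ∏ i, ENNReal.ofReal (Real.exp (-(y i ^ 2 / q))) := by
  rw [← ENNReal.ofReal_prod_of_nonneg fun i _ => (Real.exp_pos _).le, ← Real.exp_sum,
    EuclideanSpace.norm_sq_eq, Finset.sum_neg_distrib, Finset.sum_div]
  simp

theorem measurable_list_map_prod {α β : Type*} {m : MeasurableSpace α} (l : List β)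
    {g : β → α → ℝ≥0∞} (hg : ∀ x ∈ l, Measurable (g x)) :
    Measurable fun a => (l.map fun x => g x a).prod := by
  induction l with
  | nil => simp
  | cons x l ih =>
    simp only [List.map_cons, List.prod_cons]
    exact (hg x (by simp)).mul (ih fun y hy => hg y (by simp [hy]))

theorem coeFn_finset_sum_smul {Ω ι : Type*} [MeasurableSpace Ω] {P : Measure Ω} (S : Finset ι)
    (c : ι → ℝ) (f : ι → Lp ℝ 2 P) :
    ((∑ x ∈ S, c x • f x : Lp ℝ 2 P) : Ω → ℝ) =ᵐ[P] fun ω => ∑ x ∈ S, c x * f x ω := by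
  have h1 : ((∑ x ∈ S, c x • f x : Lp ℝ 2 P) : Ω → ℝ) =ᵐ[P]
      ∑ x ∈ S, ((c x • f x : Lp ℝ 2 P) : Ω → ℝ) := Lp.coeFn_finsetSum _ _
  have h2 : ∀ᵐ ω ∂P, ∀ x ∈ S, ((c x • f x : Lp ℝ 2 P) : Ω → ℝ) ω = c x * f x ω := by
    rw [Finset.eventually_all]
    intro t _
    filter_upwards [Lp.coeFn_smul (c t) (f t)] with ω hω
    simpa using hω
  filter_upwards [h1, h2] with ω hω1 hω2
  rw [hω1, Finset.sum_apply]
  exact Finset.sum_congr rfl hω2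

section

variable {Ω : Type*} [MeasurableSpace Ω] {P : Measure Ω}

/-- The expectation of the Gaussian weight of the increments `B_t - B_x`, `x ∈ l`. -/
noncomputable def incrWeight (P : Measure Ω) {d : ℕ} (B : ℝ≥0 → Ω → EuclideanSpace ℝ (Fin d))
    (q : ℝ) (t : ℝ≥0) (l : List ℝ≥0) : ℝ≥0∞ :=
  ∫⁻ ω, (l.map fun x => ENNReal.ofReal (Real.exp (-(‖B t ω - B x ω‖ ^ 2 / q)))).prod ∂P

namespace IsFractionalBrownianMotion

variable {d : ℕ} {H : ℝ} {B : ℝ≥0 → Ω → EuclideanSpace ℝ (Fin d)}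

/-- The residual of the increment at `s`, regressed on the increments at the points of `l`, is a
combination with coefficient 1 at `s`; nondeterminism bounds its variance below by `c ρ^{2H}`. Being
independent of the other increments, it integrates out. -/
theorem incrWeight_cons_le_of_forall_le [IsProbabilityMeasure P]
    (hB : IsFractionalBrownianMotion P H B) (hH : 0 < H) (hd : 0 < d) {c : ℝ} (hc : 0 < c)
    (hlnd : ∀ (ι : Type) (s : Finset ι) (w x : ι → ℝ) (t ρ : ℝ) (i₀ : ι), i₀ ∈ s →
      w i₀ = 1 → 0 < ρ → ρ ≤ |x i₀ - t| → (∀ i ∈ s, i ≠ i₀ → ρ ≤ |x i - x i₀|) →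
      c * ρ ^ (2 * H) ≤ ∑ i ∈ s, ∑ j ∈ s, w i * w j * incrCov H t (x i) (x j))
    {q : ℝ} (hq : 0 < q) {ρ : ℝ} (hρ : 0 < ρ) (t s : ℝ≥0) (l : List ℝ≥0)
    (hst : ρ ≤ |(s : ℝ) - t|) (hsl : ∀ x ∈ l, ρ ≤ |(s : ℝ) - x|) :
    incrWeight P B q t (s :: l) ≤
      ENNReal.ofReal (min 1 √(q / (2 * (c * ρ ^ (2 * H))))) ^ d * incrWeight P B q t l := by
  classical
  set S : Finset ℝ≥0 := l.toFinset with hS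
  have hsS : s ∉ S := fun h => by
    have := hsl s (by simpa [hS] using h)
    simp at this; linarith
  let i₀ : Fin d := ⟨0, hd⟩
  let V : Submodule ℝ (Lp ℝ 2 P) :=
    Submodule.span ℝ ((fun x => hB.incrL2 t x i₀) '' (S : Set ℝ≥0))
  have : FiniteDimensional ℝ V := FiniteDimensional.span_of_finite ℝ (S.finite_toSet.image _)
  -- The regression is solved in one coordinate only. Coordinates are uncorrelated and have the same
  -- covariance, so the same coefficients serve all of them.
  obtain ⟨a, ha⟩ := (Submodule.mem_span_image_finset_iff_exists_fun' ℝ).1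
    (V.starProjection_apply_mem (hB.incrL2 t s i₀))
  let w : ℝ≥0 → ℝ := fun x => if x = s then 1 else -a x
  let R : Fin d → Lp ℝ 2 P := fun i => ∑ x ∈ insert s S, w x • hB.incrL2 t x i
  have hRa : ∀ i, R i = hB.incrL2 t s i - ∑ x ∈ S, a x • hB.incrL2 t x i := fun i => by
    simp only [R]
    rw [Finset.sum_insert hsS, sub_eq_add_neg, ← Finset.sum_neg_distrib]
    congr 1
    · simp [w]
    · refine Finset.sum_congr rfl fun x hx => ?_
      have : x ≠ s := fun h => hsS (h ▸ hx)
      simp [w, this]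
  have hRf : ∀ i j y, inner ℝ (R i) (hB.incrL2 t y j) =
      if i = j then ∑ x ∈ insert s S, w x * incrCov H t x y else 0 := fun i j y => by
    simp only [R, sum_inner, real_inner_smul_left, hB.inner_incrL2 hH]
    split_ifs <;> simp
  have horth : ∀ i j, ∀ y ∈ S, inner ℝ (R i) (hB.incrL2 t y j) = 0 := fun i j y hy => by
    have h0 : inner ℝ (R i₀) (hB.incrL2 t y i₀) = 0 := by
      rw [hRa, ha]
      exact V.starProjection_inner_eq_zero _ _ (Submodule.subset_span ⟨y, hy, rfl⟩)
    rw [hRf, if_pos rfl] at h0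
    rw [hRf, h0, ite_self]
  set Q : ℝ := ∑ x ∈ insert s S, ∑ y ∈ insert s S, w x * w y * incrCov H t x y with hQ
  have hRR : ∀ i j, inner ℝ (R i) (R j) = if i = j then Q else 0 := fun i j => by
    have e : inner ℝ (R i) (R j) = ∑ y ∈ insert s S, w y * inner ℝ (R i) (hB.incrL2 t y j) := by
      conv_lhs => enter [3]; simp only [R]
      simp only [inner_sum, real_inner_smul_right]
    rw [e]
    simp only [hRf]
    split_ifs with h
    · rw [hQ, Finset.sum_comm]
      refine Finset.sum_congr rfl fun x _ => ?_
      rw [Finset.mul_sum]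
      exact Finset.sum_congr rfl fun y _ => by ring
    · simp
  have hQle : c * ρ ^ (2 * H) ≤ Q := by
    refine hlnd ℝ≥0 (insert s S) w (fun x => (x : ℝ)) t ρ s (Finset.mem_insert_self _ _)
      (by simp [w]) hρ hst fun x hx hne => ?_
    rw [abs_sub_comm]
    refine hsl x ?_
    simpa [hS, hne] using hx
  have hQ0 : 0 < Q := lt_of_lt_of_le (by positivity) hQle
  have hv : Q.toNNReal ≠ 0 := (Real.toNNReal_pos.2 hQ0).ne'
  have hRv : ∀ i, ‖R i‖₊ ^ 2 = Q.toNNReal := fun i => by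
    have h1 := hRR i i
    rw [if_pos rfl, real_inner_self_eq_norm_sq] at h1
    apply NNReal.eq
    rw [Real.coe_toNNReal _ hQ0.le, ← h1]
    simp
  -- The default 0 outside `S` keeps every member orthogonal to the residuals; `Φ` and `m` only read
  -- times in `S`, and `Φ` retains the multiplicities of `l`.
  let f : ℝ≥0 × Fin d → Lp ℝ 2 P := fun p => if p.1 ∈ S then hB.incrL2 t p.1 p.2 else 0
  have hf : ∀ p, f p ∈ hB.gaussianSpace := fun p => by
    simp only [f]; split_ifs
    · exact hB.incrL2_mem _ _ _
    · exact zero_mem _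
  have hR : ∀ i, R i ∈ hB.gaussianSpace := fun i =>
    sum_mem fun x _ => Submodule.smul_mem _ _ (hB.incrL2_mem _ _ _)
  have hRfp : ∀ i p, inner ℝ (R i) (f p) = 0 := fun i p => by
    simp only [f]; split_ifs with h
    · exact horth _ _ _ h
    · exact inner_zero_right _
  let Φ : (ℝ≥0 × Fin d → ℝ) → ℝ≥0∞ := fun z =>
    (l.map fun x => ∏ i, ENNReal.ofReal (Real.exp (-(z (x, i) ^ 2 / q)))).prod
  have hΦ : Measurable Φ := measurable_list_map_prod l fun x _ =>
    Finset.measurable_prod _ fun i _ => by fun_prop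
  let m : Fin d → (ℝ≥0 × Fin d → ℝ) → ℝ := fun i z => ∑ x ∈ S, a x * z (x, i)
  have hm : ∀ i, Measurable (m i) := fun i => by fun_prop
  have hae : ∀ᵐ ω ∂P, (∀ x ∈ S, ∀ i, f (x, i) ω = B t ω i - B x ω i) ∧
      ∀ i, B t ω i - B s ω i = m i (fun p => f p ω) + R i ω := by
    have h1 : ∀ᵐ ω ∂P, ∀ x ∈ S, ∀ i, hB.incrL2 t x i ω = B t ω i - B x ω i := by
      rw [Finset.eventually_all]
      intro x _
      rw [ae_all_iff]
      exact fun i => hB.incrL2_ae_eq t x i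
    have h2 : ∀ᵐ ω ∂P, ∀ i, hB.incrL2 t s i ω = B t ω i - B s ω i :=
      ae_all_iff.2 fun i => hB.incrL2_ae_eq t s i
    have h3 : ∀ᵐ ω ∂P, ∀ i, R i ω = hB.incrL2 t s i ω - ∑ x ∈ S, a x * hB.incrL2 t x i ω := by
      refine ae_all_iff.2 fun i => ?_
      rw [hRa]
      filter_upwards [Lp.coeFn_sub (hB.incrL2 t s i) (∑ x ∈ S, a x • hB.incrL2 t x i),
        coeFn_finset_sum_smul S a fun x => hB.incrL2 t x i] with ω e1 e2
      rw [e1, Pi.sub_apply, e2]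
    filter_upwards [h1, h2, h3] with ω e1 e2 e3
    refine ⟨fun x hx i => by simp only [f, if_pos hx]; exact e1 x hx i, fun i => ?_⟩
    rw [e3, ← e2]
    have : m i (fun p => f p ω) = ∑ x ∈ S, a x * hB.incrL2 t x i ω :=
      Finset.sum_congr rfl fun x hx => by simp [f, hx]
    rw [this]; ring
  have hΦae : ∀ᵐ ω ∂P, Φ (fun p => f p ω) =
      (l.map fun x => ENNReal.ofReal (Real.exp (-(‖B t ω - B x ω‖ ^ 2 / q)))).prod := by
    filter_upwards [hae] with ω hω
    simp only [Φ]
    congr 1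
    refine List.map_congr_left fun x hx => ?_
    rw [ofReal_exp_neg_norm_sq_div]
    refine Finset.prod_congr rfl fun i _ => ?_
    rw [hω.1 x (by simpa [hS] using hx)]
    rfl
  have key := lintegral_mul_prod_exp_le hB.isCenteredGaussianL2 hf hR hRfp
    (fun i j hij => by rw [hRR, if_neg hij]) hv hRv hq hΦ hm
  have e1 : incrWeight P B q t (s :: l) = ∫⁻ ω, Φ (fun p => f p ω) *
        ∏ i, ENNReal.ofReal (Real.exp (-((m i (fun p => f p ω) + R i ω) ^ 2 / q))) ∂P := by
    refine lintegral_congr_ae ?_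
    filter_upwards [hae, hΦae] with ω h1 h2
    rw [List.map_cons, List.prod_cons, ← h2, mul_comm, ofReal_exp_neg_norm_sq_div]
    congr 1
    refine Finset.prod_congr rfl fun i _ => ?_
    rw [← h1.2]
    rfl
  have e2 : incrWeight P B q t l = ∫⁻ ω, Φ (fun p => f p ω) ∂P :=
    lintegral_congr_ae (hΦae.mono fun ω h => h.symm)
  rw [e1, e2]
  refine key.trans (mul_le_mul_left (pow_le_pow_left' (ENNReal.ofReal_le_ofReal ?_) d) _)
  refine min_le_min_left _ (Real.sqrt_le_sqrt ?_)
  rw [Real.coe_toNNReal _ hQ0.le]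
  gcongr

end IsFractionalBrownianMotion

end

/-! ### Prediction from the past, and passage from conditional to true increments. -/

/-- The tangent line of the exponential at `-m` gives `e^{-Y} ≥ e^{-m}(1 + m - Y)`, whose right side
has mean `e^{-m}`. -/
theorem exp_neg_integral_le_integral_exp_neg {Ω : Type*} [MeasurableSpace Ω] {P : Measure Ω}
    [IsProbabilityMeasure P] {Y : Ω → ℝ} (hY : Integrable Y P) (hY0 : ∀ ω, 0 ≤ Y ω) :
    Real.exp (-∫ ω, Y ω ∂P) ≤ ∫ ω, Real.exp (-Y ω) ∂P := by
  set m := ∫ ω, Y ω ∂P with hm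
  have hI : Integrable (fun ω => Real.exp (-Y ω)) P := by
    refine Integrable.of_bound (C := 1) ?_ (Filter.Eventually.of_forall fun ω => ?_)
    · exact Real.continuous_exp.comp_aestronglyMeasurable hY.1.neg
    · rw [Real.norm_of_nonneg (Real.exp_pos _).le]
      exact Real.exp_le_one_iff.2 (by linarith [hY0 ω])
  have h1 : ∫ ω, Real.exp (-m) * (1 + (m - Y ω)) ∂P ≤ ∫ ω, Real.exp (-Y ω) ∂P := by
    refine integral_mono (((integrable_const 1).add ((integrable_const m).sub hY)).const_mul _) hI fun ω => ?_
    have h2 : Real.exp (-Y ω) = Real.exp (-m) * Real.exp (m - Y ω) := by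
      rw [← Real.exp_add]; congr 1; ring
    simp only
    rw [h2]
    refine mul_le_mul_of_nonneg_left ?_ (Real.exp_pos _).le
    linarith [Real.add_one_le_exp (m - Y ω)]
  have h3 : ∫ ω, Real.exp (-m) * (1 + (m - Y ω)) ∂P = Real.exp (-m) := by
    have hc : Integrable (fun _ : Ω => m) P := integrable_const m
    rw [integral_const_mul, integral_add (integrable_const 1) (by exact hc.sub hY),
      integral_sub hc hY, ← hm]
    simp
  rw [h3] at h1
  exact h1

theorem measurable_pastSigmaAlgebra {Ω : Type*} {d : ℕ}
    (B : ℝ≥0 → Ω → EuclideanSpace ℝ (Fin d)) {r u : ℝ≥0} (hu : u ≤ r) :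
    Measurable[pastSigmaAlgebra B r] (B u) := by
  rw [measurable_iff_comap_le]
  exact le_iSup₂ (f := fun (u : ℝ≥0) (_ : u ≤ r) => MeasurableSpace.comap (B u) inferInstance) u hu

theorem measurable_toLp_of_forall {α : Type*} {m : MeasurableSpace α} {d : ℕ} {f : Fin d → α → ℝ}
    (hf : ∀ i, Measurable (f i)) :
    Measurable fun a => (WithLp.toLp 2 fun i => f i a : EuclideanSpace ℝ (Fin d)) :=
  (WithLp.measurable_toLp 2 _).comp (measurable_pi_lambda _ hf)

section

variable {Ω : Type*} [MeasurableSpace Ω] {P : Measure Ω}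

namespace IsFractionalBrownianMotion

variable {d : ℕ} {H : ℝ} {B : ℝ≥0 → Ω → EuclideanSpace ℝ (Fin d)}

theorem pastSigmaAlgebra_le (hB : IsFractionalBrownianMotion P H B) (r : ℝ≥0) :
    pastSigmaAlgebra B r ≤ ‹MeasurableSpace Ω› :=
  iSup₂_le fun u _ => (hB.measurable u).comap_le

/-- The closed span in `L²` of the past up to time `r`. -/
noncomputable def pastL2 (hB : IsFractionalBrownianMotion P H B) (r : ℝ≥0) :
    Submodule ℝ (Lp ℝ 2 P) :=
  (Submodule.span ℝ (Set.range fun p : {u : ℝ≥0 // u ≤ r} × Fin d =>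
    hB.coordL2 (p.1, p.2))).topologicalClosure

theorem coordL2_mem_pastL2 (hB : IsFractionalBrownianMotion P H B) {r u : ℝ≥0} (hu : u ≤ r)
    (i : Fin d) : hB.coordL2 (u, i) ∈ hB.pastL2 r :=
  Submodule.le_topologicalClosure _ (Submodule.subset_span ⟨(⟨u, hu⟩, i), rfl⟩)

theorem pastL2_le (hB : IsFractionalBrownianMotion P H B) (r : ℝ≥0) :
    hB.pastL2 r ≤ hB.gaussianSpace := by
  refine Submodule.topologicalClosure_mono (Submodule.span_mono ?_)
  rintro _ ⟨p, rfl⟩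
  exact ⟨_, rfl⟩

instance (hB : IsFractionalBrownianMotion P H B) (r : ℝ≥0) :
    (hB.pastL2 r).HasOrthogonalProjection := by
  have : CompleteSpace (hB.pastL2 r) :=
    (Submodule.isClosed_topologicalClosure _).completeSpace_coe
  infer_instance

theorem aestronglyMeasurable_of_mem_pastL2 (hB : IsFractionalBrownianMotion P H B) {r : ℝ≥0}
    {f : Lp ℝ 2 P} (hf : f ∈ hB.pastL2 r) : AEStronglyMeasurable[pastSigmaAlgebra B r] f P := by
  have hcl : IsClosed {f : Lp ℝ 2 P | AEStronglyMeasurable[pastSigmaAlgebra B r] f P} :=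
    isClosed_aestronglyMeasurable (hB.pastSigmaAlgebra_le r)
  have hle : Submodule.span ℝ (Set.range fun p : {u : ℝ≥0 // u ≤ r} × Fin d =>
      hB.coordL2 (p.1, p.2)) ≤ lpMeas ℝ ℝ (pastSigmaAlgebra B r) 2 P := by
    rw [Submodule.span_le]
    rintro _ ⟨p, rfl⟩
    refine mem_lpMeas_iff_aestronglyMeasurable.2 ?_
    have h1 : Measurable[pastSigmaAlgebra B r] fun ω => B p.1 ω p.2 :=
      (by fun_prop : Measurable fun y : EuclideanSpace ℝ (Fin d) => y p.2).comp
        (measurable_pastSigmaAlgebra B p.1.2)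
    exact ⟨_, h1.stronglyMeasurable, hB.coordL2_ae_eq _⟩
  exact closure_minimal (fun g hg => mem_lpMeas_iff_aestronglyMeasurable.1 (hle hg)) hcl hf

/-- The prediction error of the `i`-th coordinate of `B_t` given the past up to time `r`. -/
noncomputable def predErr (hB : IsFractionalBrownianMotion P H B) (r t : ℝ≥0) (i : Fin d) :
    Lp ℝ 2 P :=
  hB.coordL2 (t, i) - (hB.pastL2 r).starProjection (hB.coordL2 (t, i))

theorem predErr_mem (hB : IsFractionalBrownianMotion P H B) (r t : ℝ≥0) (i : Fin d) :
    hB.predErr r t i ∈ hB.gaussianSpace :=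
  sub_mem (hB.coordL2_mem _) (hB.pastL2_le r (Submodule.starProjection_apply_mem _ _))

/-- The projection minimises the distance to the past, and `B_r` is one competitor. -/
theorem norm_sq_predErr_le (hB : IsFractionalBrownianMotion P H B) (hH : 0 < H) {r t : ℝ≥0}
    (hrt : r ≤ t) (i : Fin d) : ‖hB.predErr r t i‖ ^ 2 ≤ ((t : ℝ) - r) ^ (2 * H) := by
  have h1 : ‖hB.predErr r t i‖ ≤ ‖hB.incrL2 t r i‖ := by
    rw [predErr, Submodule.starProjection_minimal]
    exact ciInf_le ⟨0, by rintro _ ⟨x, rfl⟩; positivity⟩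
      (⟨hB.coordL2 (r, i), hB.coordL2_mem_pastL2 le_rfl i⟩ : hB.pastL2 r)
  have h2 : ‖hB.incrL2 t r i‖ ^ 2 = ((t : ℝ) - r) ^ (2 * H) := by
    have h0 : (0 : ℝ) ≤ t - r := sub_nonneg.2 (by exact_mod_cast hrt)
    rw [← real_inner_self_eq_norm_sq, hB.inner_incrL2 hH, if_pos rfl, incrCov, sub_self, abs_zero,
      Real.zero_rpow (by linarith), abs_of_nonneg h0]
    ring
  rw [← h2]
  gcongr

/-- The prediction error, as a random vector. -/
noncomputable def predErrVec (hB : IsFractionalBrownianMotion P H B) (r t : ℝ≥0) (ω : Ω) :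
    EuclideanSpace ℝ (Fin d) :=
  WithLp.toLp 2 fun i => hB.predErr r t i ω

theorem measurable_predErrVec (hB : IsFractionalBrownianMotion P H B) (r t : ℝ≥0) :
    Measurable (hB.predErrVec r t) :=
  measurable_toLp_of_forall fun i => (Lp.stronglyMeasurable (hB.predErr r t i)).measurable

theorem integrable_predErrVec [IsProbabilityMeasure P] (hB : IsFractionalBrownianMotion P H B)
    (r t : ℝ≥0) : Integrable (hB.predErrVec r t) P := by
  refine ((integrable_finsetSum Finset.univ fun i _ =>
    ((Lp.memLp (hB.predErr r t i)).integrable (by norm_num)).norm).mono'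
    (hB.measurable_predErrVec r t).aestronglyMeasurable
    (Filter.Eventually.of_forall fun ω => ?_))
  have h := norm_sum_le (Finset.univ : Finset (Fin d))
    fun i => EuclideanSpace.single i (hB.predErr r t i ω)
  simp only [PiLp.norm_single] at h
  refine le_trans (le_of_eq ?_) h
  congr 1
  ext j
  simp [predErrVec, Finset.sum_apply, Pi.single_apply]

theorem integral_predErrVec [IsProbabilityMeasure P] (hB : IsFractionalBrownianMotion P H B)
    (r t : ℝ≥0) : ∫ ω, hB.predErrVec r t ω ∂P = 0 := by
  ext i
  have h := (EuclideanSpace.proj i : EuclideanSpace ℝ (Fin d) →L[ℝ] ℝ).integral_comp_comm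
    (hB.integrable_predErrVec r t)
  change (EuclideanSpace.proj i : EuclideanSpace ℝ (Fin d) →L[ℝ] ℝ) _ = 0
  rw [← h]
  exact (hB.isCenteredGaussianL2 _ (hB.predErr_mem r t i)).integral_eq_zero

/-- The prediction error is independent of the past. -/
theorem indep_predErrVec [IsProbabilityMeasure P] (hB : IsFractionalBrownianMotion P H B)
    (r t : ℝ≥0) :
    Indep (MeasurableSpace.comap (hB.predErrVec r t) inferInstance) (pastSigmaAlgebra B r) P := by
  have h1 : IndepFun (fun ω (i : Fin d) => hB.predErr r t i ω)
      (fun ω (p : {u : ℝ≥0 // u ≤ r} × Fin d) => hB.coordL2 (p.1, p.2) ω) P :=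
    indepFun_of_inner_eq_zero hB.isCenteredGaussianL2 (hB.predErr_mem r t)
      (fun p => hB.coordL2_mem _) fun i p =>
      (hB.pastL2 r).starProjection_inner_eq_zero _ _ (hB.coordL2_mem_pastL2 p.1.2 p.2)
  have h2 : IndepFun (fun ω (i : Fin d) => hB.predErr r t i ω)
      (fun ω (p : {u : ℝ≥0 // u ≤ r} × Fin d) => B p.1 ω p.2) P :=
    h1.process_congr_right fun p => hB.coordL2_ae_eq _
  have h3 : IndepFun (hB.predErrVec r t)
      (fun ω (p : {u : ℝ≥0 // u ≤ r} × Fin d) => B p.1 ω p.2) P :=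
    h2.comp (WithLp.measurable_toLp 2 _) measurable_id
  refine indep_of_indep_of_le_right (IndepFun_iff_Indep _ _ _ |>.1 h3) ?_
  refine iSup₂_le fun u hu => ?_
  rw [← measurable_iff_comap_le]
  have h4 : B u = fun ω => WithLp.toLp 2 fun i => B u ω i := by ext; rfl
  rw [h4]
  refine measurable_toLp_of_forall fun i => ?_
  exact (measurable_pi_apply _ : Measurable fun z : {u : ℝ≥0 // u ≤ r} × Fin d → ℝ =>
    z (⟨u, hu⟩, i)).comp (comap_measurable _)

/-- `B_t` is its conditional expectation given the past plus the prediction error. -/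
theorem condExp_add_predErrVec [IsProbabilityMeasure P] (hB : IsFractionalBrownianMotion P H B)
    (r t : ℝ≥0) :
    ∀ᵐ ω ∂P, B t ω = (P[B t | pastSigmaAlgebra B r]) ω + hB.predErrVec r t ω := by
  have hm := hB.pastSigmaAlgebra_le r
  set g : Fin d → Lp ℝ 2 P := fun i => (hB.pastL2 r).starProjection (hB.coordL2 (t, i)) with hg
  have hgm : ∀ i, AEStronglyMeasurable[pastSigmaAlgebra B r] (g i) P := fun i =>
    hB.aestronglyMeasurable_of_mem_pastL2 (Submodule.starProjection_apply_mem _ _)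
  -- An `F_r`-measurable version of the `L²` projection. As the remainder is centred and independent
  -- of `F_r`, `ξ` is the conditional expectation.
  set ξ : Ω → EuclideanSpace ℝ (Fin d) := fun ω => WithLp.toLp 2 fun i => (hgm i).mk _ ω with hξ
  have hξm : StronglyMeasurable[pastSigmaAlgebra B r] ξ := by
    exact (measurable_toLp_of_forall
      fun i => (hgm i).stronglyMeasurable_mk.measurable).stronglyMeasurable
  have hdec : ∀ᵐ ω ∂P, B t ω = ξ ω + hB.predErrVec r t ω := by
    have h1 : ∀ᵐ ω ∂P, ∀ i, B t ω i = (hgm i).mk _ ω + hB.predErr r t i ω := by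
      refine ae_all_iff.2 fun i => ?_
      filter_upwards [hB.coordL2_ae_eq (t, i), (hgm i).ae_eq_mk,
        Lp.coeFn_sub (hB.coordL2 (t, i)) (g i)] with ω e1 e2 e3
      have e4 : hB.predErr r t i ω = hB.coordL2 (t, i) ω - g i ω := e3
      rw [e4, e1, ← e2]; ring
    filter_upwards [h1] with ω hω
    ext i
    exact hω i
  have hNI := hB.integrable_predErrVec r t
  have hξI : Integrable ξ P := by
    refine ((hB.integrable t).sub hNI).congr ?_
    filter_upwards [hdec] with ω hω
    simp [hω]
  have hN0 : P[hB.predErrVec r t | pastSigmaAlgebra B r] =ᵐ[P] fun _ => 0 := by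
    have h := condExp_indep_eq (hB.measurable_predErrVec r t).comap_le hm
      (comap_measurable (hB.predErrVec r t)).stronglyMeasurable (hB.indep_predErrVec r t)
    rwa [hB.integral_predErrVec] at h
  have h5 : P[B t | pastSigmaAlgebra B r] =ᵐ[P] P[ξ + hB.predErrVec r t | pastSigmaAlgebra B r] :=
    condExp_congr_ae hdec
  filter_upwards [hdec, h5, condExp_add hξI hNI (pastSigmaAlgebra B r), hN0] with ω e1 e2 e3 e4
  rw [e2, e3, Pi.add_apply, e4, condExp_of_stronglyMeasurable hm hξm hξI, add_zero, e1]

/-- The weight of the conditional increments is bounded by the weight of the increments. -/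
theorem lintegral_condIncr_weight_le [IsProbabilityMeasure P]
    (hB : IsFractionalBrownianMotion P H B) (hH : 0 < H) {r t : ℝ≥0} (hrt : r ≤ t)
    {A : ℝ → ℝ → Ω → EuclideanSpace ℝ (Fin d)} (hA : IsCondIncrement P B r A)
    {b : ℝ} (hb : 0 < b) (hbt : ((t : ℝ) - r) ^ (2 * H) ≤ b) (l : List ℝ≥0)
    (hl : ∀ x ∈ l, x ≤ r) :
    ∫⁻ ω, (l.map fun x : ℝ≥0 =>
        ENNReal.ofReal (Real.exp (-(‖A t x ω‖ ^ 2 / (4 * b))))).prod ∂P ≤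
      ENNReal.ofReal (Real.exp (d / 4)) ^ l.length * incrWeight P B (8 * b) t l := by
  have hm := hB.pastSigmaAlgebra_le r
  set N := hB.predErrVec r t with hN
  set ξ := P[B t | pastSigmaAlgebra B r] with hξ
  have hξm : Measurable[pastSigmaAlgebra B r] ξ := stronglyMeasurable_condExp.measurable
  have hAx : ∀ᵐ ω ∂P, ∀ x ∈ l.toFinset, A t x ω = ξ ω - B x ω := by
    rw [Finset.eventually_all]
    intro x hx
    have hxr : x ≤ r := hl x (by simpa using hx)
    have h1 : P[B x | pastSigmaAlgebra B r] = B x :=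
      condExp_of_stronglyMeasurable hm (measurable_pastSigmaAlgebra B hxr).stronglyMeasurable (hB.integrable x)
    filter_upwards [hA.version t x,
      condExp_sub (hB.integrable t) (hB.integrable x) (pastSigmaAlgebra B r)] with ω e1 e2
    rw [e1]
    refine e2.trans ?_
    rw [Pi.sub_apply, h1]
  set F : Ω → ℝ≥0∞ := fun ω => (l.map fun x : ℝ≥0 =>
    ENNReal.ofReal (Real.exp (-(‖ξ ω - B x ω‖ ^ 2 / (4 * b))))).prod with hF
  have hFm : Measurable[pastSigmaAlgebra B r] F := by
    refine measurable_list_map_prod l fun x hx => ?_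
    have h2 : Measurable[pastSigmaAlgebra B r] fun ω => ξ ω - B x ω :=
      hξm.sub (measurable_pastSigmaAlgebra B (hl x hx))
    exact (by fun_prop : Measurable fun y : EuclideanSpace ℝ (Fin d) =>
      ENNReal.ofReal (Real.exp (-(‖y‖ ^ 2 / (4 * b))))).comp h2
  have e1 : ∫⁻ ω, (l.map fun x : ℝ≥0 =>
        ENNReal.ofReal (Real.exp (-(‖A t x ω‖ ^ 2 / (4 * b))))).prod ∂P = ∫⁻ ω, F ω ∂P := by
    refine lintegral_congr_ae ?_
    filter_upwards [hAx] with ω hω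
    simp only [hF]
    congr 1
    exact List.map_congr_left fun x hx => by rw [hω x (by simpa using hx)]
  set n := l.length with hn
  -- All `n` factors share the same error `N`, which therefore costs `n |N|²/(4b)` in the exponent,
  -- with mean at most `n d/4`.
  set Y : Ω → ℝ := fun ω => n * (‖N ω‖ ^ 2 / (4 * b)) with hY
  have hNm : Measurable N := hB.measurable_predErrVec r t
  have hNsq : ∀ ω, ‖N ω‖ ^ 2 = ∑ i, hB.predErr r t i ω * hB.predErr r t i ω := fun ω => by
    rw [EuclideanSpace.norm_sq_eq]
    exact Finset.sum_congr rfl fun i _ => by rw [Real.norm_eq_abs, sq_abs, sq]; rfl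
  have hsqI : ∀ i, Integrable (fun ω => hB.predErr r t i ω * hB.predErr r t i ω) P := fun i =>
    (Lp.memLp (hB.predErr r t i)).integrable_mul (Lp.memLp (hB.predErr r t i))
  have hNI : Integrable (fun ω => ‖N ω‖ ^ 2) P := by
    simp_rw [hNsq]
    exact integrable_finsetSum _ fun i _ => hsqI i
  have hNle : ∫ ω, ‖N ω‖ ^ 2 ∂P ≤ d * b := by
    simp_rw [hNsq]
    rw [integral_finsetSum _ fun i _ => hsqI i]
    calc _ ≤ ∑ _i : Fin d, b := by
          refine Finset.sum_le_sum fun i _ => ?_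
          have h3 : ∫ ω, hB.predErr r t i ω * hB.predErr r t i ω ∂P = ‖hB.predErr r t i‖ ^ 2 := by
            rw [← real_inner_self_eq_norm_sq, L2.inner_def]
            simp [inner]
          rw [h3]
          exact (hB.norm_sq_predErr_le hH hrt i).trans hbt
      _ = d * b := by simp
  have hYI : Integrable Y P := (hNI.div_const _).const_mul _
  have hYle : ∫ ω, Y ω ∂P ≤ n * (d / 4) := by
    simp only [hY]
    rw [integral_const_mul, integral_div]
    refine mul_le_mul_of_nonneg_left ?_ (Nat.cast_nonneg n)
    rw [div_le_iff₀ (by positivity)]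
    linarith
  have hY0 : ∀ ω, 0 ≤ Y ω := fun ω => by positivity
  have hexp : ENNReal.ofReal (Real.exp (-(n * (d / 4)))) ≤
      ∫⁻ ω, ENNReal.ofReal (Real.exp (-Y ω)) ∂P := by
    rw [← ofReal_integral_eq_lintegral_ofReal _
      (Filter.Eventually.of_forall fun ω => (Real.exp_pos _).le)]
    · refine ENNReal.ofReal_le_ofReal (le_trans ?_ (exp_neg_integral_le_integral_exp_neg hYI hY0))
      exact Real.exp_le_exp.2 (by linarith)
    · refine Integrable.of_bound (C := 1) ?_ (Filter.Eventually.of_forall fun ω => ?_)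
      · exact Real.continuous_exp.comp_aestronglyMeasurable hYI.1.neg
      · rw [Real.norm_of_nonneg (Real.exp_pos _).le]
        exact Real.exp_le_one_iff.2 (by linarith [hY0 ω])
  have hYmeas : Measurable[MeasurableSpace.comap N inferInstance]
      fun ω => ENNReal.ofReal (Real.exp (-Y ω)) :=
    (by fun_prop : Measurable fun y : EuclideanSpace ℝ (Fin d) =>
      ENNReal.ofReal (Real.exp (-(n * (‖y‖ ^ 2 / (4 * b)))))).comp (comap_measurable N)
  have hprod := lintegral_mul_eq_lintegral_mul_lintegral_of_independent_measurableSpace hm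
    hNm.comap_le (hB.indep_predErrVec r t).symm hFm hYmeas
  have hptw : ∀ᵐ ω ∂P, F ω * ENNReal.ofReal (Real.exp (-Y ω)) ≤
      (l.map fun x => ENNReal.ofReal (Real.exp (-(‖B t ω - B x ω‖ ^ 2 / (8 * b))))).prod := by
    filter_upwards [hB.condExp_add_predErrVec r t] with ω hω
    -- Factor by factor, this is `|u + v|² ≤ 2|u|² + 2|v|²`, which explains the change from `4b` to
    -- `8b`.
    have h4 : ∀ l' : List ℝ≥0, (l'.map fun x : ℝ≥0 =>
          ENNReal.ofReal (Real.exp (-(‖ξ ω - B x ω‖ ^ 2 / (4 * b))))).prod *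
          ENNReal.ofReal (Real.exp (-(l'.length * (‖N ω‖ ^ 2 / (4 * b))))) ≤
        (l'.map fun x =>
          ENNReal.ofReal (Real.exp (-(‖B t ω - B x ω‖ ^ 2 / (8 * b))))).prod := by
      intro l'
      induction l' with
      | nil => simp
      | cons x l' ih =>
        simp only [List.map_cons, List.prod_cons, List.length_cons]
        have h5 : Real.exp (-(((l'.length + 1 : ℕ) : ℝ) * (‖N ω‖ ^ 2 / (4 * b)))) =
            Real.exp (-(‖N ω‖ ^ 2 / (4 * b))) *
              Real.exp (-(l'.length * (‖N ω‖ ^ 2 / (4 * b)))) := by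
          rw [← Real.exp_add]; congr 1; push_cast; ring
        rw [h5, ENNReal.ofReal_mul (Real.exp_pos _).le, mul_mul_mul_comm]
        refine mul_le_mul' ?_ ih
        rw [← ENNReal.ofReal_mul (Real.exp_pos _).le, ← Real.exp_add]
        refine ENNReal.ofReal_le_ofReal (Real.exp_le_exp.2 ?_)
        have h6 : B t ω - B x ω = (ξ ω - B x ω) + N ω := by rw [hω]; abel
        have h7 : ‖B t ω - B x ω‖ ^ 2 ≤ 2 * ‖ξ ω - B x ω‖ ^ 2 + 2 * ‖N ω‖ ^ 2 := by
          have h8 := norm_add_le (ξ ω - B x ω) (N ω)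
          rw [← h6] at h8
          nlinarith [norm_nonneg (B t ω - B x ω), sq_nonneg (‖ξ ω - B x ω‖ - ‖N ω‖)]
        have h9 : ‖B t ω - B x ω‖ ^ 2 / (8 * b) ≤
            ‖ξ ω - B x ω‖ ^ 2 / (4 * b) + ‖N ω‖ ^ 2 / (4 * b) := by
          rw [← add_div, div_le_div_iff₀ (by positivity) (by positivity)]
          nlinarith
        linarith
    exact h4 l
  have hfin : (∫⁻ ω, F ω ∂P) * ENNReal.ofReal (Real.exp (-(n * (d / 4)))) ≤
      incrWeight P B (8 * b) t l :=
    calc _ ≤ (∫⁻ ω, F ω ∂P) * ∫⁻ ω, ENNReal.ofReal (Real.exp (-Y ω)) ∂P :=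
          mul_le_mul_right hexp _
      _ = ∫⁻ ω, F ω * ENNReal.ofReal (Real.exp (-Y ω)) ∂P := hprod.symm
      _ ≤ _ := lintegral_mono_ae hptw
  rw [e1]
  have hone : ENNReal.ofReal (Real.exp (d / 4)) ^ n *
      ENNReal.ofReal (Real.exp (-(n * (d / 4)))) = 1 := by
    rw [← ENNReal.ofReal_pow (Real.exp_pos _).le, ← ENNReal.ofReal_mul (by positivity),
      ← Real.exp_nat_mul, ← Real.exp_add]
    simp
  calc ∫⁻ ω, F ω ∂P = ENNReal.ofReal (Real.exp (d / 4)) ^ n *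
        ((∫⁻ ω, F ω ∂P) * ENNReal.ofReal (Real.exp (-(n * (d / 4))))) := by
        rw [mul_left_comm, hone, mul_one]
    _ ≤ _ := mul_le_mul_right hfin _

end IsFractionalBrownianMotion

end

/-! ### Singular kernels, a weighted Jensen inequality and exponent trading. -/

/-- The singular kernel `|u| ^ (-a)`, with value `∞` at `0`. -/
noncomputable def singKernel (a u : ℝ) : ℝ≥0∞ := ENNReal.ofReal |u| ^ (-a)

theorem measurable_singKernel (a : ℝ) : Measurable (singKernel a) := by
  unfold singKernel; fun_prop

theorem singKernel_of_ne_zero (a : ℝ) {u : ℝ} (hu : u ≠ 0) :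
    singKernel a u = ENNReal.ofReal (|u| ^ (-a)) := by
  rw [singKernel, ENNReal.ofReal_rpow_of_pos (abs_pos.2 hu)]

theorem singKernel_zero {a : ℝ} (ha : 0 < a) : singKernel a 0 = ⊤ := by
  rw [singKernel, abs_zero, ENNReal.ofReal_zero, ENNReal.zero_rpow_of_neg (by linarith)]

theorem lintegral_singKernel_lt_top {a : ℝ} (ha : a < 1) {T : ℝ} (hT : 0 < T) :
    ∫⁻ s in Set.Icc (-T) T, singKernel a s < ⊤ := by
  have h0 : ∀ᵐ y : ℝ, y ≠ 0 := by simp [ae_iff]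
  have h1 : Integrable ((Set.Icc (-T) T).indicator fun s : ℝ => |s| ^ (-a)) := by
    apply IntegrableOn.integrable_of_even
    · rw [← Set.Ioc_union_Ioi_eq_Ioi hT.le]
      apply IntegrableOn.union
      · have h := intervalIntegral.intervalIntegrable_rpow' (a := 0) (b := T) (r := -a)
          (by linarith)
        rw [intervalIntegrable_iff_integrableOn_Ioc_of_le hT.le] at h
        refine h.congr_fun (fun x hx => ?_) measurableSet_Ioc
        have hx0 : 0 < x := hx.1
        have hxT : x ≤ T := hx.2
        rw [Set.indicator_of_mem (Set.mem_Icc.2 ⟨by linarith, hxT⟩), abs_of_pos hx0]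
      · refine integrableOn_zero.congr_fun (fun x hx => ?_) measurableSet_Ioi
        have hxT : T < x := hx
        rw [Set.indicator_of_notMem fun h => absurd h.2 (not_le.2 hxT)]
    · intro x
      have : -x ∈ Set.Icc (-T) T ↔ x ∈ Set.Icc (-T) T := by
        simp only [Set.mem_Icc]; constructor <;> rintro ⟨h, h'⟩ <;> constructor <;> linarith
      by_cases hx : x ∈ Set.Icc (-T) T
      · rw [Set.indicator_of_mem hx, Set.indicator_of_mem (this.2 hx), abs_neg]
      · rw [Set.indicator_of_notMem hx, Set.indicator_of_notMem fun h => hx (this.1 h)]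
  rw [integrable_indicator_iff measurableSet_Icc] at h1
  have h2 := h1.lintegral_lt_top
  refine lt_of_le_of_lt (le_of_eq (lintegral_congr_ae ?_)) h2
  filter_upwards [ae_restrict_of_ae h0] with s hs
  exact singKernel_of_ne_zero a hs

theorem lintegral_singKernel_sub_le (a : ℝ) {T p q y : ℝ} (hp : y - T ≤ p) (hq : q ≤ y + T) :
    ∫⁻ s in Set.Icc p q, singKernel a (s - y) ≤ ∫⁻ s in Set.Icc (-T) T, singKernel a s := by
  rw [← lintegral_indicator measurableSet_Icc, ← lintegral_indicator measurableSet_Icc,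
    ← lintegral_sub_right_eq_self ((Set.Icc (-T) T).indicator (singKernel a)) y]
  refine lintegral_mono fun s => ?_
  by_cases hs : s ∈ Set.Icc p q
  · rw [Set.indicator_of_mem hs, Set.indicator_of_mem]
    exact ⟨by linarith [hs.1], by linarith [hs.2]⟩
  · rw [Set.indicator_of_notMem hs]; exact zero_le

/-- Jensen's inequality for the power function with respect to a weighted measure. -/
theorem lintegral_mul_pow_le {α : Type*} [MeasurableSpace α] {μ : Measure α} {m Z : α → ℝ≥0∞}
    (hm : AEMeasurable m μ) (hZ : AEMeasurable Z μ) {n : ℕ} (hn : 1 ≤ n) :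
    (∫⁻ x, m x * Z x ∂μ) ^ n ≤ (∫⁻ x, m x ∂μ) ^ (n - 1) * ∫⁻ x, m x * Z x ^ n ∂μ := by
  rcases hn.eq_or_lt with rfl | hn1
  · simp
  have hn0 : (n : ℝ) ≠ 0 := by positivity
  have hn1' : (1 : ℝ) < n := by exact_mod_cast hn1
  have hpq : (n : ℝ).HolderConjugate (Real.conjExponent n) := Real.HolderConjugate.conjExponent hn1'
  set ν := μ.withDensity m with hν
  have hZν : AEMeasurable Z ν := hZ.mono_ac (withDensity_absolutelyContinuous μ m)
  -- Hölder for `Z · 1` under the measure `m dμ`; its total mass then appears to the power `n - 1`.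
  have h := ENNReal.lintegral_mul_le_Lp_mul_Lq ν hpq hZν (aemeasurable_const (b := 1))
  simp only [Pi.mul_apply, mul_one, ENNReal.one_rpow, lintegral_one] at h
  have h2 := pow_le_pow_left' h n
  rw [mul_pow, ← ENNReal.rpow_natCast (_ ^ (1 / (n : ℝ))), ← ENNReal.rpow_mul,
    one_div_mul_cancel hn0, ENNReal.rpow_one, ← ENNReal.rpow_natCast (_ ^ (1 / _)),
    ← ENNReal.rpow_mul] at h2
  have h3 : 1 / Real.conjExponent n * (n : ℝ) = ((n - 1 : ℕ) : ℝ) := by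
    rw [Real.conjExponent, Nat.cast_sub hn, Nat.cast_one]
    field_simp
  rw [h3, ENNReal.rpow_natCast] at h2
  simp only [ENNReal.rpow_natCast] at h2
  have e1 : ∀ g : α → ℝ≥0∞, AEMeasurable g μ → ∫⁻ x, g x ∂ν = ∫⁻ x, m x * g x ∂μ := fun g hg => by
    rw [hν, lintegral_withDensity_eq_lintegral_mul₀ hm hg]; rfl
  have e2 : ν Set.univ = ∫⁻ x, m x ∂μ := by
    rw [hν, withDensity_apply _ MeasurableSet.univ, Measure.restrict_univ]
  rw [e1 _ hZ, e1 _ (hZ.pow_const n), e2] at h2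
  rwa [mul_comm]

/-- Lowering the exponent from `d/2` to `θ` enlarges `z^·` for `z ≤ 1`, and the 1 in the minimum
covers `z ≥ 1`. The full exponent would produce `ρ^{-Hd}`, not integrable when `Hd ≥ 1`. -/
theorem min_one_sqrt_pow_le {z θ : ℝ} (hz : 0 < z) (hθ : 0 ≤ θ) {d : ℕ} (hθd : θ ≤ d / 2) :
    (min 1 √z) ^ d ≤ z ^ θ := by
  rcases le_total 1 z with h | h
  · exact (pow_le_one₀ (by positivity) (min_le_left _ _)).trans (Real.one_le_rpow h hθ)
  · calc (min 1 √z) ^ d ≤ √z ^ d := pow_le_pow_left₀ (by positivity) (min_le_right _ _) d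
      _ = z ^ ((d : ℝ) / 2) := by
        rw [Real.sqrt_eq_rpow, ← Real.rpow_natCast, ← Real.rpow_mul hz.le]; congr 1; ring
      _ ≤ z ^ θ := Real.rpow_le_rpow_of_exponent_ge hz h hθd

/-- The sum of the singular kernels at the distances from `s` to the points `t` and `x ∈ l`. -/
noncomputable def singSum (a : ℝ) (t : ℝ≥0) (l : List ℝ≥0) (s : ℝ) : ℝ≥0∞ :=
  ((t :: l).map fun x : ℝ≥0 => singKernel a (s - x)).sum

theorem measurable_singSum (a : ℝ) (t : ℝ≥0) (l : List ℝ≥0) : Measurable (singSum a t l) := by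
  unfold singSum
  generalize t :: l = l'
  induction l' with
  | nil => simp
  | cons x l' ih =>
    simp only [List.map_cons, List.sum_cons]
    exact ((measurable_singKernel a).comp (by fun_prop)).add ih

/-- The iterated product of the factors `κ * singSum a t l s` along a list. -/
noncomputable def singProd (a : ℝ) (t : ℝ≥0) (κ : ℝ≥0∞) : List ℝ≥0 → ℝ≥0∞
  | [] => 1
  | s :: l => κ * singSum a t l s * singProd a t κ l

theorem lintegral_singSum_le (a : ℝ) {T : ℝ} {r t : ℝ≥0} (hr : (r : ℝ) ≤ T) (ht : (t : ℝ) ≤ T)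
    {l : List ℝ≥0} (hl : ∀ x ∈ l, x ≤ r) :
    ∫⁻ s in Set.Icc (0 : ℝ) r, singSum a t l s ≤
      (l.length + 1 : ℕ) * ∫⁻ s in Set.Icc (-T) T, singKernel a s := by
  have hl' : ∀ x ∈ t :: l, (x : ℝ) ≤ T := by
    intro x hx
    rcases List.mem_cons.1 hx with rfl | hx
    · exact ht
    · exact le_trans (by exact_mod_cast hl x hx) hr
  rw [← List.length_cons (a := t)]
  unfold singSum
  generalize t :: l = l' at hl'
  induction l' with
  | nil => simp
  | cons x l' ih =>
    simp only [List.map_cons, List.sum_cons, List.length_cons]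
    have hm : Measurable fun s : ℝ => singKernel a (s - x) :=
      (measurable_singKernel a).comp (by fun_prop)
    rw [lintegral_add_left hm]
    push_cast
    rw [add_mul, one_mul, add_comm]
    refine add_le_add (ih fun y hy => hl' y (by simp [hy])) ?_
    refine lintegral_singKernel_sub_le a ?_ ?_
    · have := hl' x (by simp); linarith
    · have := x.2; change (r : ℝ) ≤ (x : ℝ) + T; have h : (0 : ℝ) ≤ x := x.2; linarith

/-! ### The moment recursion in the past times. -/

section

variable {Ω : Type*} [MeasurableSpace Ω] {P : Measure Ω}

/-- Moments of `∫_0^r e_s ds` from bounds on the expectations of the products of the `e_s`. -/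
theorem lintegral_prod_mul_pow_le [SFinite P] {a : ℝ} {r t : ℝ≥0} {e : ℝ → Ω → ℝ≥0∞}
    (hem : Measurable fun p : ℝ × Ω => e p.1 p.2) {κ D K : ℝ≥0∞}
    (hK : ∀ l : List ℝ≥0, (∀ x ∈ l, x ≤ r) →
      ∫⁻ s in Set.Icc (0 : ℝ) r, singSum a t l s ≤ (l.length + 1 : ℕ) * K)
    (hbase : ∀ l : List ℝ≥0, (∀ x ∈ l, x ≤ r) →
      ∫⁻ ω, (l.map fun x : ℝ≥0 => e x ω).prod ∂P ≤ D ^ l.length * singProd a t κ l) (n : ℕ) :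
    ∀ l : List ℝ≥0, (∀ x ∈ l, x ≤ r) →
      ∫⁻ ω, (l.map fun x : ℝ≥0 => e x ω).prod * (∫⁻ s in Set.Icc (0 : ℝ) r, e s ω) ^ n ∂P ≤
      (D * κ * K) ^ n * ((l.length + 1).ascFactorial n : ℕ) *
        (D ^ l.length * singProd a t κ l) := by
  have hes : ∀ s, Measurable (e s) := fun s => hem.comp measurable_prodMk_left
  set X : Ω → ℝ≥0∞ := fun ω => ∫⁻ s in Set.Icc (0 : ℝ) r, e s ω with hX
  have hXm : Measurable X := hem.lintegral_prod_left' (μ := volume.restrict (Set.Icc (0 : ℝ) r))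
  have hlm : ∀ l : List ℝ≥0, Measurable fun ω => (l.map fun x : ℝ≥0 => e x ω).prod := fun l =>
    measurable_list_map_prod l fun x _ => hes x
  induction n with
  | zero =>
    intro l hl
    simp only [pow_zero, mul_one, one_mul, Nat.ascFactorial_zero, Nat.cast_one]
    exact hbase l hl
  | succ n ih =>
    intro l hl
    set p := singProd a t κ l with hp
    -- By Tonelli, one factor `X` is opened as an integral over `s`, and `s` joins the list; the
    -- induction on `n` therefore runs over all lists.
    have h1 : ∫⁻ ω, (l.map fun x : ℝ≥0 => e x ω).prod * X ω ^ (n + 1) ∂P =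
        ∫⁻ s in Set.Icc (0 : ℝ) r,
          ∫⁻ ω, e s ω * (l.map fun x : ℝ≥0 => e x ω).prod * X ω ^ n ∂P := by
      rw [lintegral_lintegral_swap]
      · refine lintegral_congr fun ω => ?_
        have h2 : ∀ s, e s ω * (l.map fun x : ℝ≥0 => e x ω).prod * X ω ^ n =
            ((l.map fun x : ℝ≥0 => e x ω).prod * X ω ^ n) * e s ω := fun s => by ring
        simp_rw [h2]
        have h6 : Measurable fun s => e s ω := hem.comp measurable_prodMk_right
        rw [lintegral_const_mul _ h6, pow_succ, ← mul_assoc]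
      · refine Measurable.aemeasurable ?_
        exact (hem.mul ((hlm l).comp measurable_snd)).mul ((hXm.comp measurable_snd).pow_const n)
    rw [h1]
    set m := l.length with hm
    have h3 : ∀ s ∈ Set.Icc (0 : ℝ) r,
        ∫⁻ ω, e s ω * (l.map fun x : ℝ≥0 => e x ω).prod * X ω ^ n ∂P ≤
          ((D * κ * K) ^ n * ((m + 2).ascFactorial n : ℕ) * (D ^ (m + 1) * κ * p)) *
            singSum a t l s := by
      intro s hs
      have hs' : ((s.toNNReal : ℝ≥0) : ℝ) = s := Real.coe_toNNReal _ hs.1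
      have h4 := ih (s.toNNReal :: l) (by
        intro x hx
        rcases List.mem_cons.1 hx with rfl | hx
        · rw [← NNReal.coe_le_coe, hs']; exact hs.2
        · exact hl x hx)
      simp only [List.map_cons, List.prod_cons, List.length_cons, hs'] at h4
      refine h4.trans (le_of_eq ?_)
      rw [singProd, hs', ← hp]
      ring
    refine (setLIntegral_mono (measurable_const.mul (measurable_singSum a t l)) h3).trans ?_
    simp only [Pi.mul_apply]
    rw [lintegral_const_mul _ (measurable_singSum a t l)]
    refine (mul_le_mul_right (hK l hl) _).trans (le_of_eq ?_)
    -- The `m + 1` comes from the `s`-integral of `singSum`: the `m` points of `l` together with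
    -- `t`.
    have h5 : (m + 1).ascFactorial (n + 1) = (m + 1) * (m + 2).ascFactorial n := by
      rw [Nat.ascFactorial_succ, ← Nat.succ_ascFactorial]
    rw [h5]
    push_cast
    ring

namespace IsFractionalBrownianMotion

variable {d : ℕ} {H : ℝ} {B : ℝ≥0 → Ω → EuclideanSpace ℝ (Fin d)}

/-- With `y` the point nearest to `s` among `t` and `l`, the factor is a multiple of `|s - y|^{-a}`,
which is one term of the sum. -/
theorem incrWeight_cons_le [IsProbabilityMeasure P]
    (hB : IsFractionalBrownianMotion P H B) (hH : 0 < H) (hd : 0 < d) {c : ℝ} (hc : 0 < c)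
    (hlnd : ∀ (ι : Type) (s : Finset ι) (w x : ι → ℝ) (t ρ : ℝ) (i₀ : ι), i₀ ∈ s →
      w i₀ = 1 → 0 < ρ → ρ ≤ |x i₀ - t| → (∀ i ∈ s, i ≠ i₀ → ρ ≤ |x i - x i₀|) →
      c * ρ ^ (2 * H) ≤ ∑ i ∈ s, ∑ j ∈ s, w i * w j * incrCov H t (x i) (x j))
    {a : ℝ} (ha0 : 0 < a) (had : a ≤ H * d) {q : ℝ} (hq : 0 < q) (t s : ℝ≥0) (l : List ℝ≥0) :
    incrWeight P B q t (s :: l) ≤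
      ENNReal.ofReal ((q / (2 * c)) ^ (a / (2 * H))) * singSum a t l s * incrWeight P B q t l := by
  classical
  obtain ⟨y, hy, hmin⟩ := Finset.exists_min_image (t :: l).toFinset (fun x => |(s : ℝ) - x|)
    ⟨t, by simp⟩
  have hle : singKernel a ((s : ℝ) - y) ≤ singSum a t l s :=
    List.single_le_sum (fun _ _ => zero_le) _ (List.mem_map.2 ⟨y, by simpa using hy, rfl⟩)
  set κ := (q / (2 * c)) ^ (a / (2 * H)) with hκ
  have hκ0 : 0 < κ := by positivity
  rcases eq_or_ne ((s : ℝ) - y) 0 with h0 | h0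
  -- For coincident points the bounding factor is `∞`. Since `∞ · 0 = 0`, it must still be checked
  -- that an extra factor at most 1 does not increase the weight.
  · rw [h0, singKernel_zero ha0, top_le_iff] at hle
    rw [hle, ENNReal.mul_top (ENNReal.ofReal_pos.2 hκ0).ne']
    have h1 : incrWeight P B q t (s :: l) ≤ incrWeight P B q t l := by
      refine lintegral_mono fun ω => ?_
      rw [List.map_cons, List.prod_cons]
      refine mul_le_of_le_one_left' ?_
      rw [← ENNReal.ofReal_one]
      refine ENNReal.ofReal_le_ofReal (Real.exp_le_one_iff.2 ?_)
      have : 0 ≤ ‖B t ω - B s ω‖ ^ 2 / q := by positivity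
      linarith
    exact h1.trans (le_mul_of_one_le_left' le_top)
  · have hρ : 0 < |(s : ℝ) - y| := abs_pos.2 h0
    refine (hB.incrWeight_cons_le_of_forall_le hH hd hc hlnd hq hρ t s l (hmin t (by simp))
      fun x hx => hmin x (by simp [hx])).trans (mul_le_mul_left ?_ _)
    refine le_trans ?_ (mul_le_mul_right hle _)
    rw [singKernel_of_ne_zero a h0, ← ENNReal.ofReal_mul hκ0.le, ← ENNReal.ofReal_pow (by positivity)]
    refine ENNReal.ofReal_le_ofReal ?_
    refine (min_one_sqrt_pow_le (θ := a / (2 * H)) (by positivity) (by positivity) ?_).trans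
      (le_of_eq ?_)
    · rw [div_le_div_iff₀ (by positivity) (by positivity)]; linarith
    · set ρ := |(s : ℝ) - y|
      have e1 : q / (2 * (c * ρ ^ (2 * H))) = q / (2 * c) * (ρ ^ (2 * H))⁻¹ := by
        field_simp
      have e2 : ((ρ ^ (2 * H))⁻¹) ^ (a / (2 * H)) = ρ ^ (-a) := by
        rw [← Real.rpow_neg hρ.le, ← Real.rpow_mul hρ.le]; congr 1; field_simp
      rw [e1, Real.mul_rpow (by positivity) (by positivity), e2]

/-- The weight of the conditional increments along a list is bounded by `singProd`. -/
theorem lintegral_prod_le [IsProbabilityMeasure P]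
    (hB : IsFractionalBrownianMotion P H B) (hH : 0 < H) (hd : 0 < d) {c : ℝ} (hc : 0 < c)
    (hlnd : ∀ (ι : Type) (s : Finset ι) (w x : ι → ℝ) (t ρ : ℝ) (i₀ : ι), i₀ ∈ s →
      w i₀ = 1 → 0 < ρ → ρ ≤ |x i₀ - t| → (∀ i ∈ s, i ≠ i₀ → ρ ≤ |x i - x i₀|) →
      c * ρ ^ (2 * H) ≤ ∑ i ∈ s, ∑ j ∈ s, w i * w j * incrCov H t (x i) (x j))
    {a : ℝ} (ha0 : 0 < a) (had : a ≤ H * d){r t : ℝ≥0} (hrt : r ≤ t)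
    {A : ℝ → ℝ → Ω → EuclideanSpace ℝ (Fin d)} (hA : IsCondIncrement P B r A)
    {b : ℝ} (hb : 0 < b) (hbt : ((t : ℝ) - r) ^ (2 * H) ≤ b) {κ D : ℝ≥0∞}
    (hκ : κ = ENNReal.ofReal ((8 * b / (2 * c)) ^ (a / (2 * H))))
    (hD : D = ENNReal.ofReal (Real.exp (d / 4))) (l : List ℝ≥0) (hl : ∀ x ∈ l, x ≤ r) :
    ∫⁻ ω, (l.map fun x : ℝ≥0 =>
        ENNReal.ofReal (Real.exp (-(‖A t x ω‖ ^ 2 / (4 * b))))).prod ∂P ≤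
      D ^ l.length * singProd a t κ l := by
  have h1 : ∀ l : List ℝ≥0, incrWeight P B (8 * b) t l ≤ singProd a t κ l := by
    intro l
    induction l with
    | nil => simp [incrWeight, singProd]
    | cons s l ih =>
      refine (hB.incrWeight_cons_le hH hd hc hlnd ha0 had
        (mul_pos (by norm_num) hb) t s l).trans ?_
      rw [singProd, ← hκ]
      exact mul_le_mul_right ih _
  rw [hD]
  exact (hB.lintegral_condIncr_weight_le hH hrt hA hb hbt l hl).trans (mul_le_mul_right (h1 l) _)

/-- The moments of `∫_0^r exp (-|A_{r,t,s}|² / (4 b)) ds`. -/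
theorem lintegral_lintegral_pow_le [IsProbabilityMeasure P]
    (hB : IsFractionalBrownianMotion P H B) (hH : 0 < H) (hd : 0 < d) {c : ℝ} (hc : 0 < c)
    (hlnd : ∀ (ι : Type) (s : Finset ι) (w x : ι → ℝ) (t ρ : ℝ) (i₀ : ι), i₀ ∈ s →
      w i₀ = 1 → 0 < ρ → ρ ≤ |x i₀ - t| → (∀ i ∈ s, i ≠ i₀ → ρ ≤ |x i - x i₀|) →
      c * ρ ^ (2 * H) ≤ ∑ i ∈ s, ∑ j ∈ s, w i * w j * incrCov H t (x i) (x j))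
    {a : ℝ} (ha0 : 0 < a) (had : a ≤ H * d){r t : ℝ≥0} (hrt : r ≤ t)
    {A : ℝ → ℝ → Ω → EuclideanSpace ℝ (Fin d)} (hA : IsCondIncrement P B r A)
    {b : ℝ} (hb : 0 < b) (hbt : ((t : ℝ) - r) ^ (2 * H) ≤ b)
    {T : ℝ} (htT : (t : ℝ) ≤ T) (n : ℕ) :
    ∫⁻ ω, (∫⁻ s in Set.Icc (0 : ℝ) r,
        ENNReal.ofReal (Real.exp (-(‖A t s ω‖ ^ 2 / (4 * b))))) ^ n ∂P ≤
      (ENNReal.ofReal (Real.exp (d / 4)) *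
        ENNReal.ofReal ((8 * b / (2 * c)) ^ (a / (2 * H))) *
        ∫⁻ s in Set.Icc (-T) T, singKernel a s) ^ n * n.factorial := by
  have hAm : Measurable fun p : ℝ × Ω => A t p.1 p.2 :=
    hA.measurable.comp (f := fun p : ℝ × Ω => ((t : ℝ), p.1, p.2)) (by fun_prop)
  have hem : Measurable fun p : ℝ × Ω =>
      ENNReal.ofReal (Real.exp (-(‖A t p.1 p.2‖ ^ 2 / (4 * b)))) := by fun_prop
  -- Starting from the empty list, the ascending factorial is `1 · 2 ⋯ n = n!`.
  have h := lintegral_prod_mul_pow_le (P := P) (a := a) (r := r) (t := t)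
    (e := fun s ω => ENNReal.ofReal (Real.exp (-(‖A t s ω‖ ^ 2 / (4 * b))))) hem
    (fun l hl => lintegral_singSum_le a (T := T) (le_trans (by exact_mod_cast hrt) htT) htT hl)
    (fun l hl => hB.lintegral_prod_le hH hd hc hlnd ha0 had hrt hA hb hbt rfl rfl l hl) n [] (by simp)
  simpa [singProd, Nat.one_ascFactorial] using h

end IsFractionalBrownianMotion

end

/-! ### Exponent arithmetic, integration in `t` and conclusion. -/

/-- For `H ≤ 1/2` this follows from `Hd ≥ 1`; for `H ≥ 1/2` from `d ≥ 2`, which `Hd ≥ 1` and `H < 1`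
force. Equality occurs at `H = 1/2`, `d = 2`. -/
theorem one_le_critical_exponent {d : ℕ} {H : ℝ} (hH0 : 0 < H) (hH1 : H < 1)
    (hHd : 1 ≤ H * d) : 1 ≤ (1 / 2 + H) * (d - 1 / (2 * H)) := by
  have hd : (2 : ℝ) ≤ d := by
    have h1 : (1 : ℝ) < d := by nlinarith [(Nat.cast_nonneg d : (0 : ℝ) ≤ d)]
    have h2 : 1 < d := by exact_mod_cast h1
    exact_mod_cast h2
  have e : (1 / 2 + H) * (d - 1 / (2 * H)) = (1 / 2 + H) * (H * d - 1 / 2) / H := by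
    field_simp
  rw [e, le_div_iff₀ hH0, one_mul]
  rcases le_total H (1 / 2) with h | h
  · nlinarith
  · nlinarith

/-- The powers of `u` add up to `-H(d+1) + a + H - 1/2 = -(Hd + 1/2) + a`, which is `-a` by the
choice of `a`. -/
theorem mul_rpow_le_rpow_neg {d : ℕ} {H k ε a u : ℝ} (hH0 : 0 < H) (hk : 0 < k) (hε : 0 < ε)
    (ha : 2 * a = H * d + 1 / 2) (ha1 : a < 1) (hHd : 1 ≤ H * d) (hu : 0 < u) :
    (ε + k * u ^ (2 * H)) ^ (-(((d : ℝ) + 1) / 2)) * u ^ (H - 1 / 2) *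
        (ε + u ^ (2 * H)) ^ (a / (2 * H)) ≤
      (min k 1) ^ (-(((d : ℝ) + 1) / 2)) * u ^ (-a) := by
  set p : ℝ := u ^ (2 * H) with hp
  have hp0 : 0 < p := Real.rpow_pos_of_pos hu _
  have hm : 0 < min k 1 := lt_min hk one_pos
  have h1 : min k 1 * (ε + p) ≤ ε + k * p := by
    have h2 := min_le_left k 1
    have h3 := min_le_right k 1
    nlinarith
  have hneg : -(((d : ℝ) + 1) / 2) ≤ 0 := by
    have : (0 : ℝ) ≤ d := Nat.cast_nonneg d
    linarith
  have h4 : (ε + k * p) ^ (-(((d : ℝ) + 1) / 2)) ≤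
      (min k 1) ^ (-(((d : ℝ) + 1) / 2)) * (ε + p) ^ (-(((d : ℝ) + 1) / 2)) := by
    rw [← Real.mul_rpow hm.le (by positivity)]
    exact Real.rpow_le_rpow_of_nonpos (by positivity) h1 hneg
  have hneg2 : -(((d : ℝ) + 1) / 2) + a / (2 * H) ≤ 0 := by
    have : a / (2 * H) ≤ ((d : ℝ) + 1) / 2 := by
      rw [div_le_div_iff₀ (by positivity) (by norm_num)]
      nlinarith
    linarith
  have h5 : (ε + p) ^ (-(((d : ℝ) + 1) / 2)) * (ε + p) ^ (a / (2 * H)) ≤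
      u ^ (-(H * (d + 1)) + a) := by
    rw [← Real.rpow_add (by positivity)]
    -- The total exponent is nonpositive because `a ≤ H(d+1)`, so `ε` can be dropped; this is the
    -- source of uniformity in `ε`.
    refine (Real.rpow_le_rpow_of_nonpos hp0 (by linarith) hneg2).trans (le_of_eq ?_)
    rw [hp, ← Real.rpow_mul hu.le]
    congr 1
    field_simp
  have h6 : u ^ (-(H * (d + 1)) + a) * u ^ (H - 1 / 2) = u ^ (-a) := by
    rw [← Real.rpow_add hu]; congr 1; linarith
  calc (ε + k * p) ^ (-(((d : ℝ) + 1) / 2)) * u ^ (H - 1 / 2) * (ε + p) ^ (a / (2 * H))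
      ≤ ((min k 1) ^ (-(((d : ℝ) + 1) / 2)) * (ε + p) ^ (-(((d : ℝ) + 1) / 2))) *
          u ^ (H - 1 / 2) * (ε + p) ^ (a / (2 * H)) := by gcongr
    _ = (min k 1) ^ (-(((d : ℝ) + 1) / 2)) *
          (((ε + p) ^ (-(((d : ℝ) + 1) / 2)) * (ε + p) ^ (a / (2 * H))) * u ^ (H - 1 / 2)) := by
        ring
    _ ≤ (min k 1) ^ (-(((d : ℝ) + 1) / 2)) * (u ^ (-(H * (d + 1)) + a) * u ^ (H - 1 / 2)) := by
        gcongr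
    _ = _ := by rw [h6]

section

variable {Ω : Type*} [MeasurableSpace Ω] {P : Measure Ω}

/-- Moments of `∫ w_t X_t dt` from moments of `X_t` with weights `β_t`. -/
theorem lintegral_lintegral_mul_pow_le [SFinite P] {μ : Measure ℝ} [SFinite μ]
    {w β : ℝ → ℝ≥0∞} {X : ℝ → Ω → ℝ≥0∞} (hw : Measurable w) (hβ : Measurable β)
    (hX : Measurable fun p : ℝ × Ω => X p.1 p.2) (hβ0 : ∀ᵐ t ∂μ, β t ≠ 0 ∧ β t ≠ ⊤)
    {n : ℕ} (hn : 1 ≤ n) {M N : ℝ≥0∞} (hN : ∫⁻ t, w t * β t ∂μ ≤ N)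
    (hM : ∀ᵐ t ∂μ, ∫⁻ ω, X t ω ^ n ∂P ≤ (β t * M) ^ n * n.factorial) :
    ∫⁻ ω, (∫⁻ t, w t * X t ω ∂μ) ^ n ∂P ≤ (N * M) ^ n * n.factorial := by
  set m : ℝ → ℝ≥0∞ := fun t => w t * β t with hm
  set Z : ℝ → Ω → ℝ≥0∞ := fun t ω => (β t)⁻¹ * X t ω with hZ
  have hmm : Measurable m := hw.mul hβ
  have hZm : Measurable fun p : ℝ × Ω => Z p.1 p.2 := (hβ.comp measurable_fst).inv.mul hX
  have hmZ : ∀ ω, ∫⁻ t, w t * X t ω ∂μ = ∫⁻ t, m t * Z t ω ∂μ := fun ω => by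
    refine lintegral_congr_ae ?_
    filter_upwards [hβ0] with t ht
    simp only [hm, hZ]
    rw [mul_assoc, ← mul_assoc (β t), ENNReal.mul_inv_cancel ht.1 ht.2, one_mul]
  have h1 : ∀ ω, (∫⁻ t, w t * X t ω ∂μ) ^ n ≤
      (∫⁻ t, m t ∂μ) ^ (n - 1) * ∫⁻ t, m t * Z t ω ^ n ∂μ := fun ω => by
    rw [hmZ]
    have hZω : Measurable fun t => Z t ω := hZm.comp (measurable_prodMk_right (y := ω))
    exact lintegral_mul_pow_le hmm.aemeasurable hZω.aemeasurable hn
  have hjoint : Measurable fun p : ℝ × Ω => m p.1 * Z p.1 p.2 ^ n :=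
    (hmm.comp measurable_fst).mul (hZm.pow_const n)
  have h2 : ∫⁻ ω, ∫⁻ t, m t * Z t ω ^ n ∂μ ∂P ≤ (∫⁻ t, m t ∂μ) * (M ^ n * n.factorial) := by
    rw [← lintegral_lintegral_swap (f := fun t ω => m t * Z t ω ^ n) hjoint.aemeasurable]
    have h3 : ∀ᵐ t ∂μ, ∫⁻ ω, m t * Z t ω ^ n ∂P ≤ m t * (M ^ n * n.factorial) := by
      filter_upwards [hβ0, hM] with t ht hMt
      have hZt : Measurable fun ω => Z t ω := hZm.comp measurable_prodMk_left
      have hXt : Measurable fun ω => X t ω := hX.comp measurable_prodMk_left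
      rw [lintegral_const_mul _ (hZt.pow_const n)]
      refine mul_le_mul_right ?_ _
      simp only [hZ, mul_pow]
      rw [lintegral_const_mul _ (hXt.pow_const n)]
      refine (mul_le_mul_right hMt _).trans (le_of_eq ?_)
      rw [mul_pow, ← mul_assoc, ← mul_assoc, ← mul_pow, ENNReal.inv_mul_cancel ht.1 ht.2, one_pow,
        one_mul]
    refine (lintegral_mono_ae h3).trans (le_of_eq ?_)
    rw [lintegral_mul_const _ hmm]
  have hmeas : Measurable fun ω => ∫⁻ t, m t * Z t ω ^ n ∂μ := hjoint.lintegral_prod_left'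
  calc ∫⁻ ω, (∫⁻ t, w t * X t ω ∂μ) ^ n ∂P
      ≤ ∫⁻ ω, (∫⁻ t, m t ∂μ) ^ (n - 1) * ∫⁻ t, m t * Z t ω ^ n ∂μ ∂P := lintegral_mono h1
    _ = (∫⁻ t, m t ∂μ) ^ (n - 1) * ∫⁻ ω, ∫⁻ t, m t * Z t ω ^ n ∂μ ∂P :=
        lintegral_const_mul _ hmeas
    _ ≤ (∫⁻ t, m t ∂μ) ^ (n - 1) * ((∫⁻ t, m t ∂μ) * (M ^ n * n.factorial)) :=
        mul_le_mul_right h2 _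
    _ = (∫⁻ t, m t ∂μ) ^ n * (M ^ n * n.factorial) := by
        rw [← mul_assoc, ← pow_succ, Nat.sub_add_cancel hn]
    _ ≤ N ^ n * (M ^ n * n.factorial) := mul_le_mul_left (pow_le_pow_left' hN n) _
    _ = _ := by rw [mul_pow, mul_assoc]

theorem IsFractionalBrownianMotion.lintegral_Lam_pow_le [IsProbabilityMeasure P] {d : ℕ}
    {H T k : ℝ} {B : ℝ≥0 → Ω → EuclideanSpace ℝ (Fin d)}
    (hB : IsFractionalBrownianMotion P H B) (hH0 : 0 < H)
    (hHd1 : 1 ≤ H * d) (hHd2 : H * d < 3 / 2) (hk : 0 < k) {c : ℝ} (hc : 0 < c)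
    (hlnd : ∀ (ι : Type) (s : Finset ι) (w x : ι → ℝ) (t ρ : ℝ) (i₀ : ι), i₀ ∈ s →
      w i₀ = 1 → 0 < ρ → ρ ≤ |x i₀ - t| → (∀ i ∈ s, i ≠ i₀ → ρ ≤ |x i - x i₀|) →
      c * ρ ^ (2 * H) ≤ ∑ i ∈ s, ∑ j ∈ s, w i * w j * incrCov H t (x i) (x j))
    {a : ℝ} (ha : 2 * a = H * d + 1 / 2) {r : ℝ≥0} (hr : (r : ℝ) ≤ T)
    {A : ℝ → ℝ → Ω → EuclideanSpace ℝ (Fin d)} (hA : IsCondIncrement P B r A)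
    {ε : ℝ} (hε : 0 < ε) {n : ℕ} (hn : 1 ≤ n) :
    ∫⁻ ω, Lam H k T ε r A ω ^ n ∂P ≤
      ((ENNReal.ofReal ((min k 1) ^ (-(((d : ℝ) + 1) / 2))) *
          ∫⁻ s in Set.Icc (-T) T, singKernel a s) *
        (ENNReal.ofReal (Real.exp (d / 4)) * ENNReal.ofReal ((4 / c) ^ (a / (2 * H))) *
          ∫⁻ s in Set.Icc (-T) T, singKernel a s)) ^ n * n.factorial := by
  have hd : 0 < d := Nat.pos_of_ne_zero fun h => by simp [h] at hHd1; linarith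
  have ha0 : 0 < a := by linarith
  have ha1 : a < 1 := by linarith
  have hr0 : (0 : ℝ) ≤ r := r.2
  set w : ℝ → ℝ := fun t =>
    (ε + k * (t - r) ^ (2 * H)) ^ (-(((d : ℝ) + 1) / 2)) * (t - r) ^ (H - 1 / 2) with hw
  set b : ℝ → ℝ := fun t => ε + (t - r) ^ (2 * H) with hb
  have hH2 : 0 ≤ 2 * H := by linarith
  have hbm : Measurable b := by simp only [hb]; fun_prop
  have hwm : Measurable w := by simp only [hw]; fun_prop
  have hb0 : ∀ t ∈ Set.Icc (r : ℝ) T, 0 < b t := fun t ht => by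
    have : 0 ≤ t - r := sub_nonneg.2 ht.1
    simp only [hb]; positivity
  have hw0 : ∀ t ∈ Set.Icc (r : ℝ) T, 0 ≤ w t := fun t ht => by
    have : 0 ≤ t - r := sub_nonneg.2 ht.1
    simp only [hw]; positivity
  set X : ℝ → Ω → ℝ≥0∞ := fun t ω => ∫⁻ s in Set.Icc (0 : ℝ) r,
    ENNReal.ofReal (Real.exp (-(‖A t s ω‖ ^ 2 / (4 * b t)))) with hX
  have hXm : Measurable fun p : ℝ × Ω => X p.1 p.2 := by
    have h1 : Measurable fun q : (ℝ × Ω) × ℝ => A q.1.1 q.2 q.1.2 :=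
      hA.measurable.comp (f := fun q : (ℝ × Ω) × ℝ => (q.1.1, q.2, q.1.2)) (by fun_prop)
    have h2 : Measurable fun q : (ℝ × Ω) × ℝ =>
        ENNReal.ofReal (Real.exp (-(‖A q.1.1 q.2 q.1.2‖ ^ 2 / (4 * b q.1.1)))) :=
      ((h1.norm.pow_const 2).div
        ((hbm.comp (measurable_fst.comp measurable_fst)).const_mul 4)).neg.exp.ennreal_ofReal
    have h3 := h2.lintegral_prod_right' (ν := volume.restrict (Set.Icc (0 : ℝ) r))
    exact h3
  have hLam : ∀ ω, Lam H k T ε r A ω = ∫⁻ t in Set.Icc (r : ℝ) T, ENNReal.ofReal (w t) * X t ω := by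
    intro ω
    rw [Lam]
    refine setLIntegral_congr_fun measurableSet_Icc fun t ht => ?_
    have h1 : ∀ s, ENNReal.ofReal (Psi H k ε r t (A t s ω)) = ENNReal.ofReal (w t) *
        ENNReal.ofReal (Real.exp (-(‖A t s ω‖ ^ 2 / (4 * b t)))) := fun s => by
      rw [← ENNReal.ofReal_mul (hw0 t ht)]; rfl
    simp only [h1]
    rw [lintegral_const_mul' _ _ ENNReal.ofReal_ne_top]
  simp_rw [hLam]
  -- `β_t = b_t^{a/(2H)}` is the `t`-dependence of the moment bound for `X_t`. Dividing by it leaves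
  -- constants uniform in `t`, and the mass of `w β` is controlled by the kernel `(t-r)^{-a}`.
  refine lintegral_lintegral_mul_pow_le (μ := volume.restrict (Set.Icc (r : ℝ) T))
    (β := fun t => ENNReal.ofReal (b t ^ (a / (2 * H)))) hwm.ennreal_ofReal
    (by fun_prop) hXm ?_ hn ?_ ?_
  · refine (ae_restrict_iff' measurableSet_Icc).2 (Filter.Eventually.of_forall fun t ht => ?_)
    exact ⟨(ENNReal.ofReal_pos.2 (Real.rpow_pos_of_pos (hb0 t ht) _)).ne', ENNReal.ofReal_ne_top⟩
  · have h1 : ∀ t ∈ Set.Icc (r : ℝ) T,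
        ENNReal.ofReal (w t) * ENNReal.ofReal (b t ^ (a / (2 * H))) ≤
          ENNReal.ofReal ((min k 1) ^ (-(((d : ℝ) + 1) / 2))) * singKernel a (t - r) := by
      intro t ht
      have hm : 0 < min k 1 := lt_min hk one_pos
      rcases ht.1.eq_or_lt with h | h
      · rw [h, sub_self, singKernel_zero ha0, ENNReal.mul_top]
        · exact le_top
        · exact (ENNReal.ofReal_pos.2 (Real.rpow_pos_of_pos hm _)).ne'
      · have hu : 0 < t - r := sub_pos.2 h
        rw [singKernel_of_ne_zero a hu.ne', abs_of_pos hu, ← ENNReal.ofReal_mul (hw0 t ht),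
          ← ENNReal.ofReal_mul (by positivity)]
        exact ENNReal.ofReal_le_ofReal (mul_rpow_le_rpow_neg hH0 hk hε ha ha1 hHd1 hu)
    have hsm : Measurable fun t : ℝ => singKernel a (t - r) :=
      (measurable_singKernel a).comp (by fun_prop)
    refine (setLIntegral_mono (measurable_const.mul hsm) h1).trans ?_
    simp only [Pi.mul_apply]
    rw [lintegral_const_mul _ hsm]
    exact mul_le_mul_right (lintegral_singKernel_sub_le a (by linarith) (by linarith)) _
  · refine (ae_restrict_iff' measurableSet_Icc).2 (Filter.Eventually.of_forall fun t ht => ?_)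
    have h1 := hB.lintegral_lintegral_pow_le hH0 hd hc hlnd ha0 (by linarith) (r := r)
      (t := ⟨t, hr0.trans ht.1⟩) ht.1 hA (hb0 t ht) (le_add_of_nonneg_left hε.le) ht.2 n
    refine h1.trans (le_of_eq ?_)
    have h2 : (8 * b t / (2 * c)) ^ (a / (2 * H)) =
        b t ^ (a / (2 * H)) * (4 / c) ^ (a / (2 * H)) := by
      have h3 := hb0 t ht
      rw [← Real.mul_rpow h3.le (by positivity)]; congr 1; field_simp; norm_num
    rw [h2, ENNReal.ofReal_mul (Real.rpow_nonneg (hb0 t ht).le _)]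
    congr 2
    ring

end

theorem mainTheorem3 (d : ℕ) (H T k γ : ℝ) (hH0 : 0 < H) (hH1 : H < 1)
    (hHd1 : 1 ≤ H * d) (hHd2 : H * d < 3 / 2) (hT : 0 < T) (hk : 0 < k)
    (hγ : (1 / 2 + H) * (d - 1 / (2 * H)) < γ) :
    ∃ C : ℝ, 0 < C ∧
      ∀ (Ω : Type*) [MeasurableSpace Ω] (P : Measure Ω) [IsProbabilityMeasure P]
        (B : ℝ≥0 → Ω → EuclideanSpace ℝ (Fin d)), IsFractionalBrownianMotion P H B →
      ∀ r : ℝ≥0, (r : ℝ) ≤ T →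
      ∀ A : ℝ → ℝ → Ω → EuclideanSpace ℝ (Fin d), IsCondIncrement P B r A →
      ∀ ε : ℝ, 0 < ε → ∀ n : ℕ, 1 ≤ n →
        ∫⁻ ω, Lam H k T ε r A ω ^ n ∂P ≤ ENNReal.ofReal (C ^ n * (n.factorial : ℝ) ^ γ) := by
  obtain ⟨c, hc, hlnd⟩ := exists_le_sum_incrCov hH0 hH1
  set a : ℝ := (H * d + 1 / 2) / 2 with ha
  have hK := lintegral_singKernel_lt_top (a := a) (by linarith) hT
  set M : ℝ≥0∞ := (ENNReal.ofReal ((min k 1) ^ (-(((d : ℝ) + 1) / 2))) *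
      ∫⁻ s in Set.Icc (-T) T, singKernel a s) *
    (ENNReal.ofReal (Real.exp (d / 4)) * ENNReal.ofReal ((4 / c) ^ (a / (2 * H))) *
      ∫⁻ s in Set.Icc (-T) T, singKernel a s) with hM
  have hMtop : M ≠ ⊤ := by
    rw [hM]
    exact ENNReal.mul_ne_top (ENNReal.mul_ne_top ENNReal.ofReal_ne_top hK.ne)
      (ENNReal.mul_ne_top (ENNReal.mul_ne_top ENNReal.ofReal_ne_top ENNReal.ofReal_ne_top) hK.ne)
  -- `M` involves only `d, H, T, k`, since `c` depends on `H` alone; the `+ 1` ensures positivity.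
  refine ⟨M.toReal + 1, by positivity, ?_⟩
  intro Ω _ P _ B hB r hr A hA ε hε n hn
  refine (hB.lintegral_Lam_pow_le hH0 hHd1 hHd2 hk hc hlnd (a := a) (by rw [ha]; ring) hr hA hε
    hn).trans ?_
  have h1 : (1 : ℝ) ≤ n.factorial := by exact_mod_cast n.factorial_pos
  have h2 : (n.factorial : ℝ) ≤ (n.factorial : ℝ) ^ γ := by
    have h3 := Real.rpow_le_rpow_of_exponent_le h1
      ((one_le_critical_exponent hH0 hH1 hHd1).trans hγ.le)
    rwa [Real.rpow_one] at h3
  have h4 : M ≤ ENNReal.ofReal (M.toReal + 1) := by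
    rw [← ENNReal.ofReal_toReal hMtop]
    exact ENNReal.ofReal_le_ofReal (by rw [ENNReal.toReal_ofReal (by positivity)]; linarith)
  rw [ENNReal.ofReal_mul (by positivity), ENNReal.ofReal_pow (by positivity)]
  refine mul_le_mul' (pow_le_pow_left' h4 n) ?_
  rw [← ENNReal.ofReal_natCast]
  exact ENNReal.ofReal_le_ofReal h2
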